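/- Let $P$ be any set (of propositional letters). \emph{$\alpha$-formulae} over $P$ are built from the letters $p\in P$ and a constant $I$ with two binary operations $\otimes$ and $\to$, where $\otimes$ is strictly associative with strict neutral element $I$. Thus every $\alpha$-formula is uniquely a finite product $P_1\otimes\cdots\otimes P_n$ ($n\ge 0$, the empty product being $I$) of prime ones, a prime formula being a letter or an implication $A\to B$ of two $\alpha$-formulae $A,B$. \emph{Terms} $f\colon A\vdash B$, each with a type given by two $\alpha$-formulae, are built from the primitive terms $$\mathbf 1_A\colon A\vdash A,\quad c_{A,B}\colon A\otimes B\vdash B\otimes A,\quad \eta_{A,B}\colon B\vdash A\to(A\otimes B),\quad \varepsilon_{A,B}\colon A\otimes(A\to B)\vdash B$$ by the rules: from $f\colon A\vdash B$ and $g\colon B\vdash C$ form $g\circ f\colon A\vdash C$; from $f_1\colon A_1\vdash B_1$ and $f_2\colon A_2\vdash B_2$ form $f_1\otimes f_2\colon A_1\otimes A_2\vdash B_1\otimes B_2$; from $f\colon B_1\vdash B_2$ and an $\alpha$-formula $A$ form $A\to f\colon (A\to B_1)\vdash (A\to B_2)$. \emph{Equality} of terms of the same type is the smallest congruence (with respect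 to these three operations) such that, for all terms for which the expressions are well typed, $$f\otimes(g\otimes h)=(f\otimes g)\otimes h,\qquad f\otimes\mathbf 1_I=f=\mathbf 1_I\otimes f,$$ $$g\circ\mathbf 1_A=g,\qquad \mathbf 1_A\circ f=f,\qquad h\circ(g\circ f)=(h\circ g)\circ f,$$ $$\mathbf 1_A\otimes\mathbf 1_B=\mathbf 1_{A\otimes B},\qquad (g_1\otimes g_2)\circ(f_1\otimes f_2)=(g_1\circ f_1)\otimes(g_2\circ f_2),$$ $$c_{A',B'}\circ(f\otimes g)=(g\otimes f)\circ c_{A,B},\qquad c_{B,A}\circ c_{A,B}=\mathbf 1_{A\otimes B},\qquad c_{A\otimes B,C}=(c_{A,C}\otimes\mathbf 1_B)\circ(\mathbf 1_A\otimes c_{B,C}),$$ $$A\to(g\circ f)=(A\to g)\circ(A\to f),\qquad A\to\mathbf 1_B=\mathbf 1_{A\to B},$$ $$\eta_{A,B'}\circ f=(A\to(\mathbf 1_A\otimes f))\circ\eta_{A,B},\qquad \varepsilon_{A,B'}\circ(\mathbf 1_A\otimes(A\to f))=f\circ\varepsilon_{A,B},$$ $$\varepsilon_{A,A\otimes B}\circ(\mathbf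 1_A\otimes\eta_{A,B})=\mathbf 1_{A\otimes B},\qquad (A\to\varepsilon_{A,B})\circ\eta_{A,A\to B}=\mathbf 1_{A\to B}.$$ An $\alpha$-formula is \emph{constant} if it contains no letters, and \emph{proper} if it has no subformula $B\to C$ with $C$ constant and $B$ not constant. An occurrence of a letter in an $\alpha$-formula is \emph{positive} (\emph{negative}) if it lies in an even (odd) number of antecedents of implications; its sign in a sequent $A\vdash B$ is its sign in $A\to B$. A term of type $A\vdash B$ is \emph{proper} if $A$ and $B$ are proper, and \emph{balanced} if every letter occurring in $A\vdash B$ has exactly two occurrences in it, and these have opposite signs. \textbf{Theorem.} Let $A$ and $B$ be $\alpha$-formulae and let $f,g\colon A\vdash B$ be two balanced and proper terms of the same type. Then $f=g$. -/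

import Mathlib

namespace IL

/-- Prime `α`-formulae: propositional letters (elements of `V`) and implications `A → B`, where
`A` and `B` are `α`-formulae.  An `α`-formula is the finite sequence of its prime factors, so that
the tensor product of `α`-formulae is strictly associative with strict neutral `I`. -/
inductive PrimeFormula (V : Type*) : Type _ where
  | letter : V → PrimeFormula V
  | imp : List (PrimeFormula V) → List (PrimeFormula V) → PrimeFormula V

/-- `α`-formulae over the set `V` of letters: `[P₁, …, Pₙ]` stands for `P₁ ⊗ … ⊗ Pₙ`, where the
`Pᵢ` are prime. The constant `I` is `[]` and the operation `A ⊗ B` is `A ++ B`. -/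
abbrev Formula (V : Type*) : Type _ := List (PrimeFormula V)

/-- The constant `I`. -/
abbrev Formula.I {V : Type*} : Formula V := []

/-- The tensor product of `α`-formulae. -/
abbrev Formula.tensor {V : Type*} (A B : Formula V) : Formula V := A ++ B

/-- The implication `A → B`. -/
abbrev Formula.imp {V : Type*} (A B : Formula V) : Formula V := [PrimeFormula.imp A B]

mutual
/-- The list of signed letter occurrences of a prime formula (see `Formula.occs`). -/
def PrimeFormula.occs {V : Type*} : PrimeFormula V → List (V × Bool)
  | .letter p => [(p, true)]
  | .imp A B => (Formula.occs A).map (fun x => (x.1, !x.2)) ++ Formula.occs B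
/-- The list of all occurrences of letters in an `α`-formula, each with its sign: `true` (positive)
if it lies in an even number of antecedents of implications, `false` (negative) otherwise. -/
def Formula.occs {V : Type*} : List (PrimeFormula V) → List (V × Bool)
  | [] => []
  | P :: G => PrimeFormula.occs P ++ Formula.occs G
end

/-- An `α`-formula is constant when it contains no letters. -/
def Formula.Constant {V : Type*} (A : Formula V) : Prop := Formula.occs A = []

mutual
/-- Properness of a prime formula (see `Formula.Proper`). -/
def PrimeFormula.Proper {V : Type*} : PrimeFormula V → Prop
  | .letter _ => True
  | .imp A B => Formula.Proper A ∧ Formula.Proper B ∧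
      ¬ (Formula.Constant B ∧ ¬ Formula.Constant A)
/-- An `α`-formula is proper when it has no subformula `B → C` with `C` constant and `B` not
constant. -/
def Formula.Proper {V : Type*} : List (PrimeFormula V) → Prop
  | [] => True
  | P :: G => PrimeFormula.Proper P ∧ Formula.Proper G
end

/-- The sequent `A ⊢ B` is proper when `A` and `B` are. -/
def ProperSequent {V : Type*} (A B : Formula V) : Prop := Formula.Proper A ∧ Formula.Proper B

/-- The sequent `A ⊢ B` is balanced when every letter occurring in it has exactly two occurrences,
one positive and one negative, signs being those of the formula `A → B`. -/
def BalancedSequent {V : Type*} [DecidableEq V] (A B : Formula V) : Prop :=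
  ∀ p : V, (∃ s : Bool, (p, s) ∈ Formula.occs (Formula.imp A B)) →
    (Formula.occs (Formula.imp A B)).count (p, true) = 1 ∧
    (Formula.occs (Formula.imp A B)).count (p, false) = 1

/-- Term expressions. The terms of type `A ⊢ B` are those expressions `f` with
`Term.HasType f A B`. -/
inductive Term (V : Type*) : Type _ where
  | one : Formula V → Term V
  | c : Formula V → Formula V → Term V
  | eta : Formula V → Formula V → Term V
  | eps : Formula V → Formula V → Term V
  /-- `comp g f` is `g ∘ f`. -/
  | comp : Term V → Term V → Term V
  | tensor : Term V → Term V → Term V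
  | imp : Formula V → Term V → Term V

open Formula (I)

/-- `Term.HasType f A B` says that `f` is a term of type `A ⊢ B`. -/
inductive Term.HasType {V : Type*} : Term V → Formula V → Formula V → Prop where
  | one (A : Formula V) : HasType (.one A) A A
  | c (A B : Formula V) : HasType (.c A B) (A.tensor B) (B.tensor A)
  | eta (A B : Formula V) : HasType (.eta A B) B (A.imp (A.tensor B))
  | eps (A B : Formula V) : HasType (.eps A B) (A.tensor (A.imp B)) B
  | comp {A B C : Formula V} {f g : Term V} :
      HasType f A B → HasType g B C → HasType (.comp g f) A C
  | tensor {A₁ B₁ A₂ B₂ : Formula V} {f₁ f₂ : Term V} :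
      HasType f₁ A₁ B₁ → HasType f₂ A₂ B₂ →
        HasType (.tensor f₁ f₂) (A₁.tensor A₂) (B₁.tensor B₂)
  | imp (A : Formula V) {B₁ B₂ : Formula V} {f : Term V} :
      HasType f B₁ B₂ → HasType (.imp A f) (A.imp B₁) (A.imp B₂)

/-- `TermEq A B f g` says that `f` and `g` are equal terms of type `A ⊢ B`: it is the least
congruence on typed terms that makes `⊗` on terms strictly associative with strict neutral `1_I`
and satisfies the equalities of symmetric strict monoidal closed categories. -/
inductive TermEq {V : Type*} : Formula V → Formula V → Term V → Term V → Prop where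
  -- equivalence relation
  | refl {A B : Formula V} {f : Term V} : f.HasType A B → TermEq A B f f
  | symm {A B : Formula V} {f g : Term V} : TermEq A B f g → TermEq A B g f
  | trans {A B : Formula V} {f g h : Term V} :
      TermEq A B f g → TermEq A B g h → TermEq A B f h
  -- compatibility with the operations on terms
  | comp_congr {A B C : Formula V} {f f' g g' : Term V} :
      TermEq A B f f' → TermEq B C g g' → TermEq A C (.comp g f) (.comp g' f')
  | tensor_congr {A₁ B₁ A₂ B₂ : Formula V} {f₁ f₁' f₂ f₂' : Term V} :
      TermEq A₁ B₁ f₁ f₁' → TermEq A₂ B₂ f₂ f₂' →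
        TermEq (A₁.tensor A₂) (B₁.tensor B₂) (.tensor f₁ f₂) (.tensor f₁' f₂')
  | imp_congr (A : Formula V) {B₁ B₂ : Formula V} {f f' : Term V} :
      TermEq B₁ B₂ f f' → TermEq (A.imp B₁) (A.imp B₂) (.imp A f) (.imp A f')
  -- strictness of the language of terms
  | tensor_assoc {A₁ B₁ A₂ B₂ A₃ B₃ : Formula V} {f g h : Term V} :
      f.HasType A₁ B₁ → g.HasType A₂ B₂ → h.HasType A₃ B₃ →
        TermEq ((A₁.tensor A₂).tensor A₃) ((B₁.tensor B₂).tensor B₃)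
          (.tensor (.tensor f g) h) (.tensor f (.tensor g h))
  | tensor_one_I {A B : Formula V} {f : Term V} :
      f.HasType A B → TermEq A B (.tensor f (.one I)) f
  | one_I_tensor {A B : Formula V} {f : Term V} :
      f.HasType A B → TermEq A B (.tensor (.one I) f) f
  -- category
  | comp_one {A B : Formula V} {g : Term V} :
      g.HasType A B → TermEq A B (.comp g (.one A)) g
  | one_comp {A B : Formula V} {f : Term V} :
      f.HasType B A → TermEq B A (.comp (.one A) f) f
  | comp_assoc {A B C D : Formula V} {f g h : Term V} :
      f.HasType A B → g.HasType B C → h.HasType C D →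
        TermEq A D (.comp h (.comp g f)) (.comp (.comp h g) f)
  -- functoriality of `⊗`
  | tensor_one (A B : Formula V) :
      TermEq (A.tensor B) (A.tensor B) (.tensor (.one A) (.one B)) (.one (A.tensor B))
  | tensor_comp {A₁ B₁ C₁ A₂ B₂ C₂ : Formula V} {f₁ g₁ f₂ g₂ : Term V} :
      f₁.HasType A₁ B₁ → g₁.HasType B₁ C₁ → f₂.HasType A₂ B₂ → g₂.HasType B₂ C₂ →
        TermEq (A₁.tensor A₂) (C₁.tensor C₂)
          (.comp (.tensor g₁ g₂) (.tensor f₁ f₂)) (.tensor (.comp g₁ f₁) (.comp g₂ f₂))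
  -- symmetry
  | c_nat {A A' B B' : Formula V} {f g : Term V} :
      f.HasType A A' → g.HasType B B' →
        TermEq (A.tensor B) (B'.tensor A')
          (.comp (.c A' B') (.tensor f g)) (.comp (.tensor g f) (.c A B))
  | c_c (A B : Formula V) :
      TermEq (A.tensor B) (A.tensor B) (.comp (.c B A) (.c A B)) (.one (A.tensor B))
  | c_tensor (A B C : Formula V) :
      TermEq ((A.tensor B).tensor C) (C.tensor (A.tensor B))
        (.c (A.tensor B) C)
        (.comp (.tensor (.c A C) (.one B)) (.tensor (.one A) (.c B C)))
  -- closed structure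
  | imp_comp (A : Formula V) {B C D : Formula V} {f g : Term V} :
      f.HasType B C → g.HasType C D →
        TermEq (A.imp B) (A.imp D) (.imp A (.comp g f)) (.comp (.imp A g) (.imp A f))
  | eta_nat (A : Formula V) {B B' : Formula V} {f : Term V} :
      f.HasType B B' →
        TermEq B (A.imp (A.tensor B'))
          (.comp (.eta A B') f) (.comp (.imp A (.tensor (.one A) f)) (.eta A B))
  | imp_one (A B : Formula V) :
      TermEq (A.imp B) (A.imp B) (.imp A (.one B)) (.one (A.imp B))
  | eps_nat (A : Formula V) {B B' : Formula V} {f : Term V} :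
      f.HasType B B' →
        TermEq (A.tensor (A.imp B)) B'
          (.comp (.eps A B') (.tensor (.one A) (.imp A f))) (.comp f (.eps A B))
  | eps_eta (A B : Formula V) :
      TermEq (A.tensor B) (A.tensor B)
        (.comp (.eps A (A.tensor B)) (.tensor (.one A) (.eta A B))) (.one (A.tensor B))
  | imp_eps_eta (A B : Formula V) :
      TermEq (A.imp B) (A.imp B)
        (.comp (.imp A (.eps A B)) (.eta A (A.imp B))) (.one (A.imp B))

end IL

namespace IL

universe u
variable {V : Type u}

-- Terms modulo equality are the arrows of the free symmetric strict monoidal closed category on the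
-- letters; the claim is that a proper balanced sequent carries at most one arrow. Balance enters
-- only through linearity: no letter has two occurrences of the same sign.
--
-- Every arrow is denoted by a cut-free derivation (`Arr.Ty.cutFree`). This is a logical predicate
-- argument: terms preserve the predicates, identities satisfy them, and they imply the existence of
-- a cut-free derivation. Properness serves to delete constants: since `I → B` is isomorphic to `B`,
-- a proper formula is isomorphic to a reduced one with the same signed occurrences, where no
-- implication has `I` on either side. The factors of a reduced linear context are pairwise
-- distinct, so by `Str.unique` there is only one structural arrow between two given orderings of
-- them.
--
-- It remains to compare a cut-free derivation with an arbitrary second arrow of the same type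
-- (`CutFree.eq_of_linear`), by induction on the former. The right rule for implication is
-- invertible by transposition. For the tensor rule and the left rule, the second derivation has to
-- be rearranged so as to end with the same rule and the same premises. In a derivable sequent each
-- letter present occurs with both signs, so under linearity the two premises have disjoint sets of
-- letters. With `C` containing the letters of one premise and none of the other, `CutFree.splits`
-- and `CutFree.inverts` cut any derivation along `C`. What keeps factors from landing on the wrong
-- side is `CutFree.eq_nil`: a reduced context that derives `I` is empty.

theorem Term.HasType.unique {f : Term V} {A B A' B' : Formula V} (h : f.HasType A B)
    (h' : f.HasType A' B') : A = A' ∧ B = B' := by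
  induction h generalizing A' B' with
  | comp _ _ ih₁ ih₂ =>
    cases h' with
    | comp h₁ h₂ => exact ⟨(ih₁ h₁).1, (ih₂ h₂).2⟩
  | tensor _ _ ih₁ ih₂ =>
    cases h' with
    | tensor h₁ h₂ =>
      obtain ⟨rfl, rfl⟩ := ih₁ h₁
      obtain ⟨rfl, rfl⟩ := ih₂ h₂
      exact ⟨rfl, rfl⟩
  | imp A _ ih =>
    cases h' with
    | imp _ h =>
      obtain ⟨rfl, rfl⟩ := ih h
      exact ⟨rfl, rfl⟩
  | _ => cases h'; exact ⟨rfl, rfl⟩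

theorem TermEq.hasType {A B : Formula V} {f g : Term V} (h : TermEq A B f g) :
    f.HasType A B ∧ g.HasType A B := by
  induction h with
  | refl h => exact ⟨h, h⟩
  | symm _ ih => exact ⟨ih.2, ih.1⟩
  | trans _ _ ih₁ ih₂ => exact ⟨ih₁.1, ih₂.2⟩
  | comp_congr _ _ ih₁ ih₂ => exact ⟨.comp ih₁.1 ih₂.1, .comp ih₁.2 ih₂.2⟩
  | tensor_congr _ _ ih₁ ih₂ => exact ⟨.tensor ih₁.1 ih₂.1, .tensor ih₁.2 ih₂.2⟩
  | imp_congr A _ ih => exact ⟨.imp A ih.1, .imp A ih.2⟩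
  | tensor_assoc hf hg hh =>
    exact ⟨.tensor (.tensor hf hg) hh, by simpa using Term.HasType.tensor hf (.tensor hg hh)⟩
  | tensor_one_I hf => exact ⟨by simpa using Term.HasType.tensor hf (.one []), hf⟩
  | one_I_tensor hf => exact ⟨by simpa using Term.HasType.tensor (.one []) hf, hf⟩
  | comp_one hg => exact ⟨.comp (.one _) hg, hg⟩
  | one_comp hg => exact ⟨.comp hg (.one _), hg⟩
  | comp_assoc hf hg hh => exact ⟨.comp (.comp hf hg) hh, .comp hf (.comp hg hh)⟩
  | tensor_one A B => exact ⟨.tensor (.one _) (.one _), .one _⟩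
  | tensor_comp h₁ h₂ h₃ h₄ =>
    exact ⟨.comp (.tensor h₁ h₃) (.tensor h₂ h₄), .tensor (.comp h₁ h₂) (.comp h₃ h₄)⟩
  | c_nat hf hg => exact ⟨.comp (.tensor hf hg) (.c _ _), .comp (.c _ _) (.tensor hg hf)⟩
  | c_c A B => exact ⟨.comp (.c _ _) (.c _ _), .one _⟩
  | c_tensor A B C =>
    refine ⟨.c _ _, ?_⟩
    have h₁ := Term.HasType.tensor (.one A) (.c B C)
    have h₂ := Term.HasType.tensor (.c A C) (.one B)
    simp only [Formula.tensor, List.append_assoc] at h₁ h₂ ⊢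
    exact .comp h₁ h₂
  | imp_comp A hf hg => exact ⟨.imp A (.comp hf hg), .comp (.imp A hf) (.imp A hg)⟩
  | eta_nat A hf => exact ⟨.comp hf (.eta _ _), .comp (.eta _ _) (.imp A (.tensor (.one A) hf))⟩
  | imp_one A B => exact ⟨.imp A (.one _), .one _⟩
  | eps_nat A hf => exact ⟨.comp (.tensor (.one A) (.imp A hf)) (.eps _ _), .comp (.eps _ _) hf⟩
  | eps_eta A B => exact ⟨.comp (.tensor (.one A) (.eta A B)) (.eps _ _), .one _⟩
  | imp_eps_eta A B => exact ⟨.comp (.eta _ _) (.imp A (.eps A B)), .one _⟩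

-- Arrows: terms modulo equality

/-- Equality of terms, with all ill-typed expressions identified. -/
instance Term.setoid (V : Type u) : Setoid (Term V) where
  -- A type of either side suffices, so related expressions have the same types, which transitivity
  -- needs; two untypable expressions are related vacuously.
  r f g := ∀ A B, f.HasType A B ∨ g.HasType A B → TermEq A B f g
  iseqv :=
    { refl := fun _ _ _ h => .refl (h.elim id id)
      symm := fun h A B h' => (h A B h'.symm).symm
      trans := fun {f g k} h₁ h₂ A B h => by
        rcases h with h | h
        · have := h₁ A B (.inl h)
          exact this.trans (h₂ A B (.inl this.hasType.2))
        · have := h₂ A B (.inr h)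
          exact (h₁ A B (.inr this.hasType.1)).trans this }

theorem TermEq.equiv {A B : Formula V} {f g : Term V} (h : TermEq A B f g) : f ≈ g := by
  intro A' B' h'
  rcases h' with h' | h'
  · obtain ⟨rfl, rfl⟩ := h.hasType.1.unique h'
    exact h
  · obtain ⟨rfl, rfl⟩ := h.hasType.2.unique h'
    exact h

/-- Arrows of the free symmetric strict monoidal closed category on `V`, together with one junk
element, the class of the ill-typed expressions. -/
def Arr (V : Type u) : Type u := Quotient (Term.setoid V)

namespace Arr

/-- The arrow denoted by a term. -/
def mk (f : Term V) : Arr V := Quotient.mk _ f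

/-- `f.Ty A B` says that `f` is an arrow from `A` to `B`. -/
def Ty (f : Arr V) (A B : Formula V) : Prop :=
  Quotient.lift (fun t : Term V => t.HasType A B)
    (fun _ _ h => propext ⟨fun h' => (h A B (.inl h')).hasType.2,
      fun h' => (h A B (.inr h')).hasType.1⟩) f

/-- The identity arrow. -/
def one (A : Formula V) : Arr V := mk (.one A)
/-- The symmetry. -/
def c (A B : Formula V) : Arr V := mk (.c A B)
/-- The unit of the closed structure. -/
def eta (A B : Formula V) : Arr V := mk (.eta A B)
/-- The counit of the closed structure. -/
def eps (A B : Formula V) : Arr V := mk (.eps A B)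

/-- Composition of arrows, `comp g f` being `g ∘ f`. -/
def comp : Arr V → Arr V → Arr V :=
  Quotient.map₂ Term.comp (by
    intro g g' hg f f' hf A B h
    rcases h with h | h
    · cases h with
      | comp h₁ h₂ => exact .comp_congr (hf _ _ (.inl h₁)) (hg _ _ (.inl h₂))
    · cases h with
      | comp h₁ h₂ => exact .comp_congr (hf _ _ (.inr h₁)) (hg _ _ (.inr h₂)))

/-- Tensor product of arrows. -/
def tensor : Arr V → Arr V → Arr V :=
  Quotient.map₂ Term.tensor (by
    intro g g' hg f f' hf A B h
    rcases h with h | h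
    · cases h with
      | tensor h₁ h₂ => exact .tensor_congr (hg _ _ (.inl h₁)) (hf _ _ (.inl h₂))
    · cases h with
      | tensor h₁ h₂ => exact .tensor_congr (hg _ _ (.inr h₁)) (hf _ _ (.inr h₂)))

/-- The functor `A → _` on arrows. -/
def imp (A : Formula V) : Arr V → Arr V :=
  Quotient.map (Term.imp A) (by
    intro f f' hf A B h
    rcases h with h | h
    · cases h with
      | imp _ h => exact .imp_congr _ (hf _ _ (.inl h))
    · cases h with
      | imp _ h => exact .imp_congr _ (hf _ _ (.inr h)))

infixr:75 " ⊚ " => Arr.comp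

instance : Mul (Arr V) := ⟨tensor⟩
instance : One (Arr V) := ⟨one []⟩

theorem one_nil : one ([] : Formula V) = 1 := rfl

theorem ty_one (A : Formula V) : (one A).Ty A A := Term.HasType.one A
theorem ty_one_nil : (1 : Arr V).Ty [] [] := Term.HasType.one []
theorem ty_c (A B : Formula V) : (c A B).Ty (A ++ B) (B ++ A) := Term.HasType.c A B
theorem ty_eta (A B : Formula V) : (eta A B).Ty B [.imp A (A ++ B)] := Term.HasType.eta A B
theorem ty_eps (A B : Formula V) : (eps A B).Ty (A ++ [.imp A B]) B := Term.HasType.eps A B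

theorem Ty.comp {f g : Arr V} {A B B' C : Formula V} (hg : g.Ty B' C) (hf : f.Ty A B)
    (h : B = B' := by simp) : (g ⊚ f).Ty A C := by
  subst h
  induction f using Quotient.inductionOn
  induction g using Quotient.inductionOn
  exact Term.HasType.comp hf hg

theorem Ty.tensor {f g : Arr V} {A B C D : Formula V} (hf : f.Ty A B) (hg : g.Ty C D) :
    (f * g).Ty (A ++ C) (B ++ D) := by
  induction f using Quotient.inductionOn
  induction g using Quotient.inductionOn
  exact Term.HasType.tensor hf hg

theorem Ty.imp {f : Arr V} {A B : Formula V} (hf : f.Ty A B) (C : Formula V) :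
    (f.imp C).Ty [.imp C A] [.imp C B] := by
  induction f using Quotient.inductionOn
  exact Term.HasType.imp C hf

theorem Ty.cast {f : Arr V} {A B A' B' : Formula V} (hf : f.Ty A B) (hA : A = A' := by simp)
    (hB : B = B' := by simp) : f.Ty A' B' := hA ▸ hB ▸ hf

theorem comp_assoc (h g f : Arr V) : (h ⊚ g) ⊚ f = h ⊚ g ⊚ f := by
  induction f using Quotient.inductionOn
  induction g using Quotient.inductionOn
  induction h using Quotient.inductionOn
  refine Quotient.sound fun A B h => .symm ?_
  rcases h with h | h
  · cases h with
    | comp h₁ h₂ =>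
      cases h₂ with
      | comp h₂ h₃ => exact .comp_assoc h₁ h₂ h₃
  · cases h with
    | comp h₁ h₂ =>
      cases h₁ with
      | comp h₁ h₃ => exact .comp_assoc h₁ h₃ h₂

/-- Strictness needs no typing hypotheses here: a type of one side is a type of the other, and
untypable expressions are identified. Tensor products of arrows can thus be rewritten as in any
monoid. -/
instance : Monoid (Arr V) where
  mul_assoc f g h := by
    induction f using Quotient.inductionOn
    induction g using Quotient.inductionOn
    induction h using Quotient.inductionOn
    refine Quotient.sound fun A B h => ?_
    rcases h with h | h
    · cases h with
      | tensor h₁ h₂ =>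
        cases h₁ with
        | tensor h₁ h₃ => exact .tensor_assoc h₁ h₃ h₂
    · cases h with
      | tensor h₁ h₂ =>
        cases h₂ with
        | tensor h₂ h₃ => simpa using TermEq.tensor_assoc h₁ h₂ h₃
  one_mul f := by
    induction f using Quotient.inductionOn
    refine Quotient.sound fun A B h => ?_
    rcases h with h | h
    · cases h with
      | tensor h₁ h₂ => cases h₁; exact .one_I_tensor h₂
    · exact .one_I_tensor h
  mul_one f := by
    induction f using Quotient.inductionOn
    refine Quotient.sound fun A B h => ?_
    rcases h with h | h
    · cases h with
      | tensor h₁ h₂ => cases h₂; simpa using TermEq.tensor_one_I h₁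
    · exact .tensor_one_I h

theorem one_mul_one (A B : Formula V) : one A * one B = one (A ++ B) :=
  Quotient.sound (TermEq.tensor_one A B).equiv

theorem one_cons (P : PrimeFormula V) (A : Formula V) : one (P :: A) = one [P] * one A :=
  (one_mul_one [P] A).symm

theorem comp_one {f : Arr V} {A B : Formula V} (h : f.Ty A B) : f ⊚ one A = f := by
  induction f using Quotient.inductionOn
  exact Quotient.sound (TermEq.comp_one h).equiv

theorem one_comp {f : Arr V} {A B : Formula V} (h : f.Ty A B) : one B ⊚ f = f := by
  induction f using Quotient.inductionOn
  exact Quotient.sound (TermEq.one_comp h).equiv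

theorem tensor_comp {f₁ g₁ f₂ g₂ : Arr V} {A₁ B₁ C₁ A₂ B₂ C₂ : Formula V} (hg₁ : g₁.Ty B₁ C₁)
    (hf₁ : f₁.Ty A₁ B₁) (hg₂ : g₂.Ty B₂ C₂) (hf₂ : f₂.Ty A₂ B₂) :
    (g₁ * g₂) ⊚ (f₁ * f₂) = (g₁ ⊚ f₁) * (g₂ ⊚ f₂) := by
  induction f₁ using Quotient.inductionOn
  induction f₂ using Quotient.inductionOn
  induction g₁ using Quotient.inductionOn
  induction g₂ using Quotient.inductionOn
  exact Quotient.sound (TermEq.tensor_comp hf₁ hg₁ hf₂ hg₂).equiv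

theorem c_nat {f g : Arr V} {A A' B B' : Formula V} (hf : f.Ty A A') (hg : g.Ty B B') :
    c A' B' ⊚ (f * g) = (g * f) ⊚ c A B := by
  induction f using Quotient.inductionOn
  induction g using Quotient.inductionOn
  exact Quotient.sound (TermEq.c_nat hf hg).equiv

theorem c_c (A B : Formula V) : c B A ⊚ c A B = one (A ++ B) :=
  Quotient.sound (TermEq.c_c A B).equiv

theorem c_append (A B C : Formula V) :
    c (A ++ B) C = (c A C * one B) ⊚ (one A * c B C) :=
  Quotient.sound (TermEq.c_tensor A B C).equiv

theorem imp_comp (A : Formula V) {f g : Arr V} {B C D : Formula V} (hg : g.Ty C D)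
    (hf : f.Ty B C) : (g ⊚ f).imp A = g.imp A ⊚ f.imp A := by
  induction f using Quotient.inductionOn
  induction g using Quotient.inductionOn
  exact Quotient.sound (TermEq.imp_comp A hf hg).equiv

theorem imp_one (A B : Formula V) : (one B).imp A = one [.imp A B] :=
  Quotient.sound (TermEq.imp_one A B).equiv

theorem eta_nat (A : Formula V) {f : Arr V} {B B' : Formula V} (hf : f.Ty B B') :
    eta A B' ⊚ f = (one A * f).imp A ⊚ eta A B := by
  induction f using Quotient.inductionOn
  exact Quotient.sound (TermEq.eta_nat A hf).equiv

theorem eps_nat (A : Formula V) {f : Arr V} {B B' : Formula V} (hf : f.Ty B B') :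
    eps A B' ⊚ (one A * f.imp A) = f ⊚ eps A B := by
  induction f using Quotient.inductionOn
  exact Quotient.sound (TermEq.eps_nat A hf).equiv

theorem eps_eta (A B : Formula V) : eps A (A ++ B) ⊚ (one A * eta A B) = one (A ++ B) :=
  Quotient.sound (TermEq.eps_eta A B).equiv

theorem imp_eps_eta (A B : Formula V) :
    (eps A B).imp A ⊚ eta A [.imp A B] = one [.imp A B] :=
  Quotient.sound (TermEq.imp_eps_eta A B).equiv

theorem termEq_of_mk_eq {A B : Formula V} {f g : Term V} (hf : f.HasType A B)
    (h : mk f = mk g) : TermEq A B f g :=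
  Quotient.exact h A B (.inl hf)

/-- Interchange, splitting off the first factor. -/
theorem mul_eq_left {f g : Arr V} {A B C D : Formula V} (hf : f.Ty A B) (hg : g.Ty C D) :
    f * g = (f * one D) ⊚ (one A * g) := by
  rw [tensor_comp hf (ty_one _) (ty_one _) hg, comp_one hf, one_comp hg]

/-- Interchange, splitting off the second factor. -/
theorem mul_eq_right {f g : Arr V} {A B C D : Formula V} (hf : f.Ty A B) (hg : g.Ty C D) :
    f * g = (one B * g) ⊚ (f * one C) := by
  rw [tensor_comp (ty_one _) hf hg (ty_one _), comp_one hg, one_comp hf]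

theorem mul_one_comp {f g : Arr V} {A B C : Formula V} (hg : g.Ty B C) (hf : f.Ty A B)
    (D : Formula V) : (g ⊚ f) * one D = (g * one D) ⊚ (f * one D) := by
  rw [tensor_comp hg hf (ty_one _) (ty_one _), comp_one (ty_one D)]

theorem one_mul_comp {f g : Arr V} {A B C : Formula V} (hg : g.Ty B C) (hf : f.Ty A B)
    (D : Formula V) : one D * (g ⊚ f) = (one D * g) ⊚ (one D * f) := by
  rw [tensor_comp (ty_one _) (ty_one _) hg hf, comp_one (ty_one D)]

/-- Transposition along `A ⊗ _ ⊣ A → _`. -/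
def curry (A Γ : Formula V) (f : Arr V) : Arr V := f.imp A ⊚ eta A Γ

theorem Ty.curry {f : Arr V} {A Γ B : Formula V} (hf : f.Ty (A ++ Γ) B) :
    (f.curry A Γ).Ty Γ [.imp A B] := (hf.imp A).comp (ty_eta A Γ) rfl

theorem curry_comp {f g : Arr V} {A Γ Δ B : Formula V} (hf : f.Ty (A ++ Γ) B) (hg : g.Ty Δ Γ) :
    (f ⊚ (one A * g)).curry A Δ = f.curry A Γ ⊚ g := by
  rw [curry, imp_comp A hf ((ty_one A).tensor hg), comp_assoc, ← eta_nat A hg, ← comp_assoc]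
  rfl

theorem curry_uncurry {f : Arr V} {A Γ B : Formula V} (hf : f.Ty Γ [.imp A B]) :
    (eps A B ⊚ (one A * f)).curry A Γ = f := by
  rw [curry_comp (ty_eps A B) hf, curry, imp_eps_eta, one_comp hf]

theorem uncurry_curry {f : Arr V} {A Γ B : Formula V} (hf : f.Ty (A ++ Γ) B) :
    eps A B ⊚ (one A * f.curry A Γ) = f := by
  rw [curry, one_mul_comp (hf.imp A) (ty_eta A Γ), ← comp_assoc, eps_nat A hf, comp_assoc,
    eps_eta, comp_one hf]

/-- The hexagon with both first factors empty makes `c [] A` idempotent; being invertible, it is an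
identity. -/
theorem c_nil_left (A : Formula V) : c [] A = one A := by
  have h := c_append [] [] A
  rw [one_nil, mul_one, one_mul] at h
  have h₂ := congrArg (fun x => c A [] ⊚ x) h
  have h₃ : (c [] A).Ty A A := (ty_c [] A).cast
  have h₄ := c_c [] A
  simp only [List.nil_append] at h h₂ h₄
  rw [← comp_assoc, h₄, one_comp h₃] at h₂
  exact h₂.symm

theorem c_nil_right (A : Formula V) : c A [] = one A := by
  have h := c_c A []
  have h₃ : (c A []).Ty A A := (ty_c A []).cast
  rw [c_nil_left, one_comp h₃] at h
  simpa using h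

/-- The inverse of the hexagon `c_append`: both sides are left inverses of the invertible arrow `c
(B ++ C) A`. -/
theorem c_append_right (A B C : Formula V) :
    c A (B ++ C) = (one B * c A C) ⊚ (c A B * one C) := by
  have t₁ : (one B * c A C).Ty (B ++ A ++ C) (B ++ C ++ A) :=
    ((ty_one B).tensor (ty_c A C)).cast
  have t₂ : (c A B * one C).Ty (A ++ B ++ C) (B ++ A ++ C) := (ty_c A B).tensor (ty_one C)
  have t₃ : (one B * c C A).Ty (B ++ C ++ A) (B ++ A ++ C) :=
    ((ty_one B).tensor (ty_c C A)).cast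
  have t₄ : (c B A * one C).Ty (B ++ A ++ C) (A ++ B ++ C) := (ty_c B A).tensor (ty_one C)
  have h : ((one B * c A C) ⊚ (c A B * one C)) ⊚ c (B ++ C) A = one (B ++ C ++ A) := by
    rw [c_append B C A, comp_assoc, ← comp_assoc (c A B * one C),
      tensor_comp (ty_c A B) (ty_c B A) (ty_one C) (ty_one C), c_c, comp_one (ty_one C),
      one_mul_one, one_comp t₃, tensor_comp (ty_one B) (ty_one B) (ty_c A C) (ty_c C A), c_c,
      comp_one (ty_one B), one_mul_one, List.append_assoc]
  have h₂ := congrArg (fun x => x ⊚ c A (B ++ C)) h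
  simp only [comp_assoc, c_c] at h₂
  rw [one_comp (ty_c A (B ++ C))] at h₂
  rw [← h₂, comp_one (t₂.cast (by simp) rfl)]

end Arr

open Arr

-- Structural isomorphisms and their coherence

/-- Structural isomorphisms: `Str Γ Δ σ` says that `σ : Γ ⊢ Δ` is a composite of transpositions of
adjacent prime factors. -/
inductive Str : Formula V → Formula V → Arr V → Prop
  | nil : Str [] [] 1
  | cons (P : PrimeFormula V) {Γ Δ : Formula V} {σ : Arr V} :
      Str Γ Δ σ → Str (P :: Γ) (P :: Δ) (one [P] * σ)
  | swap (P Q : PrimeFormula V) (Γ : Formula V) :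
      Str (P :: Q :: Γ) (Q :: P :: Γ) (c [P] [Q] * one Γ)
  | trans {Γ Δ Θ : Formula V} {σ τ : Arr V} : Str Γ Δ σ → Str Δ Θ τ → Str Γ Θ (τ ⊚ σ)

namespace Str

theorem ty {Γ Δ : Formula V} {σ : Arr V} (h : Str Γ Δ σ) : σ.Ty Γ Δ := by
  induction h with
  | nil => exact ty_one_nil
  | cons P _ ih => exact (ty_one [P]).tensor ih
  | swap P Q Γ => exact (ty_c [P] [Q]).tensor (ty_one Γ)
  | trans _ _ ih₁ ih₂ => exact ih₂.comp ih₁ rfl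

theorem cast {Γ Δ Γ' Δ' : Formula V} {σ : Arr V} (h : Str Γ Δ σ) (hΓ : Γ = Γ' := by simp)
    (hΔ : Δ = Δ' := by simp) : Str Γ' Δ' σ := hΓ ▸ hΔ ▸ h

theorem perm {Γ Δ : Formula V} {σ : Arr V} (h : Str Γ Δ σ) : Γ.Perm Δ := by
  induction h with
  | nil => exact .nil
  | cons P _ ih => exact .cons P ih
  | swap P Q Γ => exact .swap Q P Γ
  | trans _ _ ih₁ ih₂ => exact ih₁.trans ih₂

theorem refl (Γ : Formula V) : Str Γ Γ (one Γ) := by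
  induction Γ with
  | nil => exact .nil
  | cons P Γ ih => simpa [one_mul_one] using Str.cons P ih

theorem exists_of_perm {Γ Δ : Formula V} (h : Γ.Perm Δ) : ∃ σ, Str Γ Δ σ := by
  induction h with
  | nil => exact ⟨_, .nil⟩
  | cons P _ ih => exact ⟨_, .cons P ih.choose_spec⟩
  | swap P Q Γ => exact ⟨_, .swap Q P Γ⟩
  | trans _ _ ih₁ ih₂ => exact ⟨_, ih₁.choose_spec.trans ih₂.choose_spec⟩

theorem exists_inv {Γ Δ : Formula V} {σ : Arr V} (h : Str Γ Δ σ) :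
    ∃ τ, Str Δ Γ τ ∧ τ ⊚ σ = one Γ ∧ σ ⊚ τ = one Δ := by
  induction h with
  | nil => exact ⟨1, .nil, one_comp (ty_one []), one_comp (ty_one [])⟩
  | cons P h ih =>
    obtain ⟨τ, h', h₁, h₂⟩ := ih
    refine ⟨_, .cons P h', ?_, ?_⟩
    · rw [← one_mul_comp h'.ty h.ty, h₁, one_mul_one]; rfl
    · rw [← one_mul_comp h.ty h'.ty, h₂, one_mul_one]; rfl
  | swap P Q Γ =>
    refine ⟨_, .swap Q P Γ, ?_, ?_⟩
    · rw [← mul_one_comp (ty_c [Q] [P]) (ty_c [P] [Q]), c_c, one_mul_one]; rfl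
    · rw [← mul_one_comp (ty_c [P] [Q]) (ty_c [Q] [P]), c_c, one_mul_one]; rfl
  | trans h h' ih ih' =>
    obtain ⟨τ, t, h₁, h₂⟩ := ih
    obtain ⟨τ', t', h₁', h₂'⟩ := ih'
    refine ⟨_, t'.trans t, ?_, ?_⟩
    · rw [comp_assoc, ← comp_assoc τ', h₁', one_comp h.ty, h₁]
    · rw [comp_assoc, ← comp_assoc _ τ, h₂, one_comp t'.ty, h₂']

theorem append_left (Ξ : Formula V) {Γ Δ : Formula V} {σ : Arr V} (h : Str Γ Δ σ) :
    Str (Ξ ++ Γ) (Ξ ++ Δ) (one Ξ * σ) := by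
  induction Ξ with
  | nil => simpa [one_nil] using h
  | cons P Ξ ih => simpa [one_cons P Ξ, mul_assoc] using Str.cons P ih

theorem append_right (Ξ : Formula V) {Γ Δ : Formula V} {σ : Arr V} (h : Str Γ Δ σ) :
    Str (Γ ++ Ξ) (Δ ++ Ξ) (σ * one Ξ) := by
  induction h with
  | nil => simpa using refl Ξ
  | cons P _ ih => simpa [mul_assoc] using Str.cons P ih
  | swap P Q Γ => simpa [mul_assoc, one_mul_one] using Str.swap P Q (Γ ++ Ξ)
  | trans h h' ih ih' => rw [mul_one_comp h'.ty h.ty]; exact ih.trans ih'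

theorem tensor {Γ Δ Γ' Δ' : Formula V} {σ τ : Arr V} (h : Str Γ Δ σ) (h' : Str Γ' Δ' τ) :
    Str (Γ ++ Γ') (Δ ++ Δ') (σ * τ) := by
  rw [mul_eq_right h.ty h'.ty]
  exact (h.append_right _).trans (h'.append_left _)

theorem symmetry (Γ Δ : Formula V) : Str (Γ ++ Δ) (Δ ++ Γ) (Arr.c Γ Δ) := by
  induction Γ with
  | nil => simpa [c_nil_left] using refl Δ
  | cons P Γ ih =>
    have h : ∀ Δ : Formula V, Str ([P] ++ Δ) (Δ ++ [P]) (Arr.c [P] Δ) := by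
      intro Δ
      induction Δ with
      | nil => simpa [c_nil_right] using refl [P]
      | cons Q Δ ih =>
        have := c_append_right [P] [Q] Δ
        simp only [List.cons_append, List.nil_append] at this
        rw [this]
        exact (Str.swap P Q Δ).trans (.cons Q ih)
    have := c_append [P] Γ Δ
    simp only [List.cons_append, List.nil_append] at this
    rw [this]
    exact (Str.cons P ih).trans (by simpa using (h Δ).append_right Γ)

/-- A structural isomorphism moves each factor of its source to some position of its target. -/
theorem track {Γ Δ : Formula V} {σ : Arr V} (h : Str Γ Δ σ) (X : Formula V) (P : PrimeFormula V)
    (Y : Formula V) (e : Γ = X ++ P :: Y) :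
    ∃ X' Y' σ', Δ = X' ++ P :: Y' ∧ Str (X ++ Y) (X' ++ Y') σ' ∧
      (Arr.c X' [P] * one Y') ⊚ σ = (one [P] * σ') ⊚ (Arr.c X [P] * one Y) := by
  induction h generalizing X Y with
  | nil => simp at e
  | @cons Q Γ Δ σ h ih =>
    cases X with
    | nil =>
      obtain ⟨rfl, rfl⟩ := List.cons.inj e
      refine ⟨[], Δ, σ, rfl, h, ?_⟩
      have t : (one [Q] * σ).Ty (Q :: Γ) (Q :: Δ) := (ty_one [Q]).tensor h.ty
      have e₁ : ∀ Γ, one [Q] * one Γ = one (Q :: Γ) := one_mul_one [Q]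
      rw [c_nil_left, e₁, e₁, one_comp t, comp_one t]
    | cons R X =>
      obtain ⟨rfl, rfl⟩ := List.cons.inj e
      obtain ⟨X', Y', σ', rfl, h', e'⟩ := ih X Y rfl
      refine ⟨Q :: X', Y', one [Q] * σ', rfl, h'.cons Q, ?_⟩
      have t₁ : (Arr.c X' [P] * one Y').Ty (X' ++ P :: Y') (P :: (X' ++ Y')) :=
        ((ty_c X' [P]).tensor (ty_one Y')).cast
      have t₂ : (Arr.c X [P] * one Y).Ty (X ++ P :: Y) (P :: (X ++ Y)) :=
        ((ty_c X [P]).tensor (ty_one Y)).cast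
      have t₃ : (one [P] * σ').Ty (P :: (X ++ Y)) (P :: (X' ++ Y')) := (ty_one [P]).tensor h'.ty
      -- The hexagon: `P` moves to the front past `X` and then past `Q`.
      have e₁ : ∀ X Y : Formula V, Arr.c (Q :: X) [P] * one Y =
          (Arr.c [Q] [P] * one (X ++ Y)) ⊚ (one [Q] * (Arr.c X [P] * one Y)) := by
        intro X Y
        have := c_append [Q] X [P]
        simp only [List.cons_append, List.nil_append] at this
        rw [this, mul_one_comp (B := Q :: P :: X) (C := P :: Q :: X) (A := Q :: (X ++ [P]))
          ((ty_c [Q] [P]).tensor (ty_one X)) ((ty_one [Q]).tensor (ty_c X [P]))]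
        simp only [mul_assoc, one_mul_one]
      rw [e₁ X Y, e₁ X' Y', comp_assoc, ← one_mul_comp t₁ h.ty, e', one_mul_comp t₃ t₂, ← comp_assoc,
        ← comp_assoc]
      congr 1
      rw [← mul_assoc, one_mul_one, ← mul_assoc, one_mul_one,
        tensor_comp (ty_c [Q] [P]) (ty_one _) (ty_one _) h'.ty,
        tensor_comp (ty_one _) (ty_c [Q] [P]) h'.ty (ty_one _), one_comp h'.ty, comp_one h'.ty]
      erw [comp_one (ty_c [Q] [P]), one_comp (ty_c [Q] [P])]
  | swap Q R Γ =>
    -- The tracked factor is the first of the swapped pair, the second, or lies beyond both; in the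
    -- last case naturality of the symmetry is what is used.
    match X, e with
    | [], e =>
      obtain ⟨rfl, rfl⟩ := List.cons.inj e
      refine ⟨[R], Γ, one (R :: Γ), rfl, refl _, ?_⟩
      have e₁ : one [Q] * one (R :: Γ) = one (Q :: R :: Γ) := one_mul_one [Q] _
      rw [← mul_one_comp (ty_c [R] [Q]) (ty_c [Q] [R]), c_c, c_nil_left, e₁, one_mul_one]
      exact (one_comp (ty_one _)).symm
    | [_], e =>
      simp only [List.cons_append, List.nil_append, List.cons.injEq] at e
      obtain ⟨rfl, rfl, rfl⟩ := e
      refine ⟨[], Q :: Γ, one (Q :: Γ), rfl, refl _, ?_⟩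
      rw [c_nil_left, one_mul_one]
    | _ :: _ :: X, e =>
      simp only [List.cons_append, List.cons.injEq] at e
      obtain ⟨rfl, rfl, rfl⟩ := e
      refine ⟨R :: Q :: X, Y, Arr.c [Q] [R] * one (X ++ Y), rfl, .swap Q R _, ?_⟩
      have t : (Arr.c X [P] * one Y).Ty (X ++ P :: Y) (P :: (X ++ Y)) :=
        ((ty_c X [P]).tensor (ty_one Y)).cast
      have e₁ : ∀ Q R : PrimeFormula V, Arr.c (Q :: R :: X) [P] * one Y =
          (Arr.c [Q, R] [P] * one (X ++ Y)) ⊚ (one [Q, R] * (Arr.c X [P] * one Y)) := by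
        intro Q R
        have := c_append [Q, R] X [P]
        simp only [List.cons_append, List.nil_append] at this
        rw [this, mul_one_comp (B := Q :: R :: P :: X) (C := P :: Q :: R :: X)
          (A := Q :: R :: (X ++ [P])) ((ty_c [Q, R] [P]).tensor (ty_one X))
          ((ty_one [Q, R]).tensor (ty_c X [P]))]
        simp only [mul_assoc, one_mul_one]
      have e₂ := c_nat (ty_c [Q] [R]) (ty_one [P])
      have s₁ : (Arr.c [Q] [R]).Ty [Q, R] [R, Q] := ty_c [Q] [R]
      have e₃ : (one [R, Q] * (Arr.c X [P] * one Y)) ⊚ (Arr.c [Q] [R] * one (X ++ P :: Y)) =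
          ((Arr.c [Q] [R] * one [P]) * one (X ++ Y)) ⊚ (one [Q, R] * (Arr.c X [P] * one Y)) := by
        rw [← mul_eq_right s₁ t, mul_eq_left s₁ t, mul_assoc, one_mul_one]
        rfl
      rw [e₁ R Q, e₁ Q R, comp_assoc, e₃, ← comp_assoc, ← comp_assoc,
        ← mul_one_comp (ty_c [R, Q] [P]) (s₁.tensor (ty_one [P])), ← mul_assoc (one [P]),
        ← mul_one_comp (C := [P, R, Q]) ((ty_one [P]).tensor s₁) (ty_c [Q, R] [P])]
      congr 2
  | trans h₁ h₂ ih₁ ih₂ =>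
    obtain ⟨X₁, Y₁, σ₁, rfl, s₁, e₁⟩ := ih₁ X Y e
    obtain ⟨X₂, Y₂, σ₂, rfl, s₂, e₂⟩ := ih₂ X₁ Y₁ rfl
    refine ⟨X₂, Y₂, _, rfl, s₁.trans s₂, ?_⟩
    rw [← comp_assoc, e₂, comp_assoc, e₁, ← comp_assoc, one_mul_comp s₂.ty s₁.ty]

theorem eq_one {Γ Δ : Formula V} {σ : Arr V} (h : Str Γ Δ σ) (e : Γ = []) : Δ = [] ∧ σ = 1 := by
  induction h with
  | nil => exact ⟨rfl, rfl⟩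
  | cons | swap => simp at e
  | trans _ _ ih₁ ih₂ =>
    obtain ⟨rfl, rfl⟩ := ih₁ e
    obtain ⟨rfl, rfl⟩ := ih₂ rfl
    exact ⟨rfl, one_comp (ty_one [])⟩

/-- Coherence for structural isomorphisms of products without repetitions. -/
theorem unique {Γ Δ : Formula V} {σ τ : Arr V} (hσ : Str Γ Δ σ) (hτ : Str Γ Δ τ)
    (hΓ : Γ.Nodup) : σ = τ := by
  induction Δ generalizing Γ σ τ with
  | nil =>
    obtain rfl := hσ.perm.eq_nil
    rw [(hσ.eq_one rfl).2, (hτ.eq_one rfl).2]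
  | cons P Δ ih =>
    have hΔ := (hσ.perm.nodup_iff).1 hΓ
    obtain ⟨X, Y, rfl⟩ := List.append_of_mem (hσ.perm.symm.subset (List.mem_cons_self ..))
    -- Without repetitions the tracked `P` can only land at the head of the target, so `ρ` is
    -- determined by its action on the remaining factors.
    have key : ∀ ρ, Str (X ++ P :: Y) (P :: Δ) ρ →
        ∃ ρ', Str (X ++ Y) Δ ρ' ∧ ρ = (one [P] * ρ') ⊚ (Arr.c X [P] * one Y) := by
      intro ρ hρ
      obtain ⟨X', Y', ρ', e, s, e'⟩ := hρ.track X P Y rfl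
      cases X' with
      | nil =>
        obtain ⟨-, rfl⟩ := List.cons.inj e
        refine ⟨ρ', s, ?_⟩
        rw [c_nil_left, one_mul_one] at e'
        exact (one_comp hρ.ty).symm.trans e'
      | cons Q X' =>
        obtain ⟨rfl, rfl⟩ := List.cons.inj e
        simp at hΔ
    obtain ⟨σ', s, rfl⟩ := key σ hσ
    obtain ⟨τ', t, rfl⟩ := key τ hτ
    rw [ih s t ((List.perm_middle.nodup_iff.1 hΓ).of_cons)]

end Str

-- Cut-free derivations

/-- The application of an implication `A → B` to an argument `k : Δ ⊢ A`. -/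
def Arr.appl (A B : Formula V) (k : Arr V) : Arr V := eps A B ⊚ (k * one [.imp A B])

theorem Arr.Ty.appl {k : Arr V} {Δ A : Formula V} (hk : k.Ty Δ A) (B : Formula V) :
    (k.appl A B).Ty (Δ ++ [.imp A B]) B :=
  (ty_eps A B).comp (hk.tensor (ty_one _)) rfl

theorem Arr.Ty.appl_mul_one {k : Arr V} {Δ A : Formula V} (hk : k.Ty Δ A) (B Θ : Formula V) :
    (k.appl A B * one Θ).Ty (Δ ++ .imp A B :: Θ) (B ++ Θ) :=
  ((hk.appl B).tensor (ty_one Θ)).cast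

/-- Arrows denoted by cut-free derivations of the sequent `Γ ⊢ S`. -/
inductive CutFree : Formula V → Formula V → Arr V → Prop
  | letter (p : V) : CutFree [.letter p] [.letter p] (one [.letter p])
  | unit : CutFree [] [] 1
  | tensor {Γ Δ S T : Formula V} {f g : Arr V} :
      CutFree Γ S f → CutFree Δ T g → CutFree (Γ ++ Δ) (S ++ T) (f * g)
  | curry {A Γ B : Formula V} {f : Arr V} :
      CutFree (A ++ Γ) B f → CutFree Γ [.imp A B] (f.curry A Γ)
  | left {A B Δ Θ S : Formula V} {k h : Arr V} : CutFree Δ A k → CutFree (B ++ Θ) S h →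
      CutFree (Δ ++ .imp A B :: Θ) S (h ⊚ (k.appl A B * one Θ))
  | perm {Γ Γ' S : Formula V} {f σ : Arr V} :
      CutFree Γ S f → Str Γ' Γ σ → CutFree Γ' S (f ⊚ σ)

theorem CutFree.ty {Γ S : Formula V} {f : Arr V} (h : CutFree Γ S f) : f.Ty Γ S := by
  induction h with
  | letter p => exact ty_one _
  | unit => exact ty_one_nil
  | tensor _ _ ih₁ ih₂ => exact ih₁.tensor ih₂
  | curry _ ih => exact ih.curry
  | left _ _ ih₁ ih₂ => exact ih₂.comp (ih₁.appl_mul_one _ _) rfl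
  | perm _ h ih => exact ih.comp h.ty rfl

-- Cut elimination by logical predicates

/-- Classes of arrows into `S` that are closed under the left rule for implication and under
exchange. -/
structure LeftClosed (S : Formula V) (X : Formula V → Arr V → Prop) : Prop where
  ty {Γ : Formula V} {f : Arr V} : X Γ f → f.Ty Γ S
  left {A B Δ Θ : Formula V} {k h : Arr V} : CutFree Δ A k → X (B ++ Θ) h →
      X (Δ ++ .imp A B :: Θ) (h ⊚ (k.appl A B * one Θ))
  perm {Γ Γ' : Formula V} {f σ : Arr V} : X Γ f → Str Γ' Γ σ → X Γ' (f ⊚ σ)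

theorem CutFree.leftClosed (S : Formula V) : LeftClosed S (fun Γ f => CutFree Γ S f) :=
  ⟨CutFree.ty, .left, .perm⟩

/-- Moving a context past an arrow. -/
theorem Arr.one_mul_mul_one {x : Arr V} {Γ B : Formula V} (hx : x.Ty Γ B) (Ξ Θ : Formula V) :
    one Ξ * (x * one Θ) =
      (Arr.c B Ξ * one Θ) ⊚ (x * one (Ξ ++ Θ)) ⊚ (Arr.c Ξ Γ * one Θ) := by
  have h : one Ξ * x = Arr.c B Ξ ⊚ (x * one Ξ) ⊚ Arr.c Ξ Γ := by
    rw [← comp_assoc, c_nat hx (ty_one Ξ), comp_assoc, c_c,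
      comp_one ((ty_one Ξ).tensor hx)]
  rw [← mul_assoc, h, mul_one_comp (ty_c B Ξ) ((hx.tensor (ty_one Ξ)).comp (ty_c Ξ Γ) rfl),
    mul_one_comp (hx.tensor (ty_one Ξ)) (ty_c Ξ Γ), mul_assoc, one_mul_one]

/-- The left rule acts at the front of the context; by naturality of the symmetry, exchanges before
and after it let it act behind a prefix `Ξ`. -/
theorem LeftClosed.left_middle {S : Formula V} {X : Formula V → Arr V → Prop}
    (hX : LeftClosed S X) {A B Δ Ξ Θ : Formula V} {k h : Arr V} (hk : CutFree Δ A k)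
    (hh : X (Ξ ++ (B ++ Θ)) h) :
    X (Ξ ++ (Δ ++ .imp A B :: Θ)) (h ⊚ (one Ξ * (k.appl A B * one Θ))) := by
  rw [one_mul_mul_one (hk.ty.appl B), ← comp_assoc, ← comp_assoc]
  have s₁ : Str (B ++ (Ξ ++ Θ)) (Ξ ++ (B ++ Θ)) (Arr.c B Ξ * one Θ) := by
    simpa using (Str.symmetry B Ξ).append_right Θ
  have s₂ : Str (Ξ ++ (Δ ++ .imp A B :: Θ)) (Δ ++ .imp A B :: (Ξ ++ Θ))
      (Arr.c Ξ (Δ ++ [.imp A B]) * one Θ) :=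
    ((Str.symmetry Ξ (Δ ++ [.imp A B])).append_right Θ).cast
  exact hX.perm (hX.left hk (hX.perm hh s₁)) s₂

/-- The closure of a class of arrows under the left rule for implication and exchange. -/
inductive LeftClosure (X : Formula V → Arr V → Prop) : Formula V → Arr V → Prop
  | base {Γ : Formula V} {f : Arr V} : X Γ f → LeftClosure X Γ f
  | left {A B Δ Θ : Formula V} {k h : Arr V} : CutFree Δ A k → LeftClosure X (B ++ Θ) h →
      LeftClosure X (Δ ++ .imp A B :: Θ) (h ⊚ (k.appl A B * one Θ))
  | perm {Γ Γ' : Formula V} {f σ : Arr V} :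
      LeftClosure X Γ f → Str Γ' Γ σ → LeftClosure X Γ' (f ⊚ σ)

theorem LeftClosure.ty {X : Formula V → Arr V → Prop} {S : Formula V}
    (hX : ∀ {Γ f}, X Γ f → f.Ty Γ S) {Γ : Formula V} {f : Arr V} (h : LeftClosure X Γ f) :
    f.Ty Γ S := by
  induction h with
  | base h => exact hX h
  | left h _ ih => exact ih.comp (h.ty.appl_mul_one _ _) rfl
  | perm _ h ih => exact ih.comp h.ty rfl

theorem LeftClosure.leftClosed {X : Formula V → Arr V → Prop} {S : Formula V}
    (hX : ∀ {Γ f}, X Γ f → f.Ty Γ S) : LeftClosed S (LeftClosure X) :=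
  ⟨LeftClosure.ty hX, .left, .perm⟩

/-- Postcomposition with an arrow maps a closure to a closed class as soon as it does so on the
generators. -/
theorem LeftClosure.comp_mem {X Y : Formula V → Arr V → Prop} {S : Formula V} {g : Arr V}
    (hY : LeftClosed S Y) (h : ∀ {Γ f}, X Γ f → Y Γ (g ⊚ f)) {Γ : Formula V} {f : Arr V}
    (hf : LeftClosure X Γ f) : Y Γ (g ⊚ f) := by
  induction hf with
  | base hf => exact h hf
  | left hk _ ih => rw [← comp_assoc]; exact hY.left hk ih
  | perm _ hσ ih => rw [← comp_assoc]; exact hY.perm ih hσ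

theorem LeftClosure.mem {X Y : Formula V → Arr V → Prop} {S : Formula V}
    (hY : LeftClosed S Y) (h : ∀ {Γ f}, X Γ f → Y Γ f) {Γ : Formula V} {f : Arr V}
    (hf : LeftClosure X Γ f) : Y Γ f := by
  induction hf with
  | base hf => exact h hf
  | left hk _ ih => exact hY.left hk ih
  | perm _ hσ ih => exact hY.perm ih hσ

mutual
/-- The logical predicate of a prime formula. -/
def RedPrime : PrimeFormula V → Formula V → Arr V → Prop
  | .letter p, Γ, f => CutFree Γ [.letter p] f
  | .imp A B, Γ, f => f.Ty Γ [.imp A B] ∧ ∀ Δ a, LeftClosure (RedTensor A) Δ a →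
      LeftClosure (RedTensor B) (Δ ++ Γ) (eps A B ⊚ (a * f))
/-- Tensor products of arrows satisfying the logical predicates of the factors. -/
def RedTensor : List (PrimeFormula V) → Formula V → Arr V → Prop
  | [], Γ, f => Γ = [] ∧ f = 1
  | P :: A, Γ, f => ∃ Γ₁ Γ₂ f₁ f₂, RedPrime P Γ₁ f₁ ∧ RedTensor A Γ₂ f₂ ∧
      Γ = Γ₁ ++ Γ₂ ∧ f = f₁ * f₂
end

/-- The logical predicate of a formula. -/
def Red (A : Formula V) : Formula V → Arr V → Prop := LeftClosure (RedTensor A)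

theorem RedPrime.ty {P : PrimeFormula V} {Γ : Formula V} {f : Arr V} (h : RedPrime P Γ f) :
    f.Ty Γ [P] := by
  cases P with
  | letter p => rw [RedPrime] at h; exact h.ty
  | imp A B => rw [RedPrime] at h; exact h.1

theorem RedTensor.ty {A Γ : Formula V} {f : Arr V} (h : RedTensor A Γ f) : f.Ty Γ A := by
  induction A generalizing Γ f with
  | nil => rw [RedTensor] at h; obtain ⟨rfl, rfl⟩ := h; exact ty_one_nil
  | cons P A ih =>
    rw [RedTensor] at h
    obtain ⟨Γ₁, Γ₂, f₁, f₂, h₁, h₂, rfl, rfl⟩ := h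
    exact h₁.ty.tensor (ih h₂)

theorem Red.leftClosed (A : Formula V) : LeftClosed A (Red A) :=
  LeftClosure.leftClosed RedTensor.ty

theorem Red.ty {A Γ : Formula V} {f : Arr V} (h : Red A Γ f) : f.Ty Γ A :=
  (Red.leftClosed A).ty h

theorem redTensor_append {A B Γ : Formula V} {f : Arr V} : RedTensor (A ++ B) Γ f ↔
    ∃ Γ₁ Γ₂ f₁ f₂, RedTensor A Γ₁ f₁ ∧ RedTensor B Γ₂ f₂ ∧ Γ = Γ₁ ++ Γ₂ ∧ f = f₁ * f₂ := by
  induction A generalizing Γ f with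
  | nil => simp [RedTensor]
  | cons P A ih =>
    simp only [List.cons_append, RedTensor, ih]
    constructor
    · rintro ⟨Γ₁, _, f₁, _, h₁, ⟨Γ₂, Γ₃, f₂, f₃, h₂, h₃, rfl, rfl⟩, rfl, rfl⟩
      exact ⟨_, _, _, _, ⟨_, _, _, _, h₁, h₂, rfl, rfl⟩, h₃, by simp, (mul_assoc _ _ _).symm⟩
    · rintro ⟨_, Γ₃, _, f₃, ⟨Γ₁, Γ₂, f₁, f₂, h₁, h₂, rfl, rfl⟩, h₃, rfl, rfl⟩
      exact ⟨_, _, _, _, h₁, ⟨_, _, _, _, h₂, h₃, rfl, rfl⟩, by simp, mul_assoc _ _ _⟩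

theorem redTensor_singleton {P : PrimeFormula V} {Γ : Formula V} {f : Arr V} :
    RedTensor [P] Γ f ↔ RedPrime P Γ f := by
  simp [RedTensor]

/-- Left rules and exchanges applied to either factor can be pulled out of a tensor product, those
on the second factor with the help of `left_middle`. -/
theorem Red.tensor {A B Γ Δ : Formula V} {f g : Arr V} (hf : Red A Γ f) (hg : Red B Δ g) :
    Red (A ++ B) (Γ ++ Δ) (f * g) := by
  induction hf with
  | @base Γ f hf =>
    induction hg with
    | base hg => exact .base (redTensor_append.2 ⟨_, _, _, _, hf, hg, rfl, rfl⟩)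
    | @left A' B' Δ Θ k h hk hh ih =>
      have e : f * (h ⊚ (k.appl A' B' * one Θ)) =
          (f * h) ⊚ (one Γ * (k.appl A' B' * one Θ)) := by
        rw [tensor_comp hf.ty (ty_one _) (Red.ty hh) (hk.ty.appl_mul_one _ _), comp_one hf.ty]
      rw [e]
      exact (Red.leftClosed _).left_middle hk ih
    | @perm Δ Δ' h σ hh hσ ih =>
      have e : f * (h ⊚ σ) = (f * h) ⊚ (one Γ * σ) := by
        rw [tensor_comp hf.ty (ty_one _) (Red.ty hh) hσ.ty, comp_one hf.ty]
      rw [e]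
      exact .perm ih (hσ.append_left _)
  | @left A' B' Δ' Θ k h hk hh ih =>
    have e : (h ⊚ (k.appl A' B' * one Θ)) * g = (h * g) ⊚ (k.appl A' B' * one (Θ ++ Δ)) := by
      rw [← one_mul_one, ← mul_assoc, tensor_comp (Red.ty hh) (hk.ty.appl_mul_one _ _) hg.ty
        (ty_one _), comp_one hg.ty]
    rw [e]
    simpa [Red] using LeftClosure.left (Θ := Θ ++ Δ) hk (by simpa [Red] using ih)
  | @perm Γ Γ' h σ hh hσ ih =>
    have e : (h ⊚ σ) * g = (h * g) ⊚ (σ * one Δ) := by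
      rw [tensor_comp (Red.ty hh) hσ.ty hg.ty (ty_one _), comp_one hg.ty]
    rw [e]
    exact .perm ih (hσ.append_right Δ)

/-- Every term preserves the logical predicates. -/
theorem Red.comp {A B : Formula V} {t : Term V} (ht : t.HasType A B) {Γ : Formula V} {a : Arr V}
    (ha : Red A Γ a) : Red B Γ (Arr.mk t ⊚ a) := by
  induction ht generalizing Γ a with
  | one A => rw [← one, one_comp ha.ty]; exact ha
  | c A B =>
    -- An arrow into `A ++ B` need not be a tensor product, but the generators of the closure are,
    -- and `comp_mem` reduces the claim to them.
    refine LeftClosure.comp_mem (Red.leftClosed _) (fun {Γ f} h => ?_) ha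
    obtain ⟨Γ₁, Γ₂, f₁, f₂, h₁, h₂, rfl, rfl⟩ := redTensor_append.1 h
    have := c_nat h₁.ty h₂.ty
    rw [Arr.c] at this
    rw [this]
    exact .perm (.base (redTensor_append.2 ⟨_, _, _, _, h₂, h₁, rfl, rfl⟩)) (.symmetry _ _)
  | eta A B =>
    refine .base (redTensor_singleton.2 ?_)
    rw [RedPrime]
    refine ⟨(ty_eta A B).comp ha.ty rfl, fun Δ a' ha' => ?_⟩
    -- The triangle identity: applying the transposed arrow to `a'` gives back the tensor product.
    have e : eps A (A ++ B) ⊚ (a' * (eta A B ⊚ a)) = a' * a := by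
      have t : (a' * a).Ty (Δ ++ Γ) (A ++ B) := (Red.ty ha').tensor ha.ty
      rw [← one_comp (Red.ty ha'), ← tensor_comp (ty_one A) (Red.ty ha') (ty_eta A B) ha.ty,
        one_comp (Red.ty ha'), ← comp_assoc, eps_eta, one_comp t]
    have := Red.tensor ha' ha
    rw [← e] at this
    exact this
  | eps A B =>
    refine LeftClosure.comp_mem (Red.leftClosed _) (fun {Γ f} h => ?_) ha
    obtain ⟨Γ₁, Γ₂, f₁, f₂, h₁, h₂, rfl, rfl⟩ := redTensor_append.1 h
    rw [redTensor_singleton, RedPrime] at h₂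
    exact h₂.2 _ _ (.base h₁)
  | @comp A B C f g hf hg ih₁ ih₂ =>
    have := ih₂ (ih₁ ha)
    rw [← comp_assoc] at this
    exact this
  | @tensor A₁ B₁ A₂ B₂ f₁ f₂ h₁ h₂ ih₁ ih₂ =>
    refine LeftClosure.comp_mem (Red.leftClosed _) (fun {Γ f} h => ?_) ha
    obtain ⟨Γ₁, Γ₂, a₁, a₂, h₁', h₂', rfl, rfl⟩ := redTensor_append.1 h
    have := (ih₁ (.base h₁')).tensor (ih₂ (.base h₂'))
    have t₁ : (Arr.mk f₁).Ty A₁ B₁ := h₁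
    have t₂ : (Arr.mk f₂).Ty A₂ B₂ := h₂
    rw [← tensor_comp t₁ h₁'.ty t₂ h₂'.ty] at this
    exact this
  | @imp A B₁ B₂ f h ih =>
    refine LeftClosure.comp_mem (Red.leftClosed _) (fun {Γ a} ha => ?_) ha
    rw [redTensor_singleton, RedPrime] at ha
    refine .base (redTensor_singleton.2 ?_)
    rw [RedPrime]
    have hf : (Arr.mk f).Ty B₁ B₂ := h
    refine ⟨(hf.imp A).comp ha.1 rfl, fun Δ a' ha' => ?_⟩
    have := ih (ha.2 _ _ ha')
    rw [← comp_assoc, ← eps_nat A hf, comp_assoc,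
      tensor_comp (ty_one A) (Red.ty ha') (hf.imp A) ha.1, one_comp (Red.ty ha')] at this
    exact this

-- The two directions need each other at `A → B`. The identity satisfies the predicate since
-- arguments in `Red A` are cut-free and the identity of `B` is in `Red B`; an arrow satisfying the
-- predicate is cut-free since it can be applied to the identity of `A`, which yields a cut-free
-- arrow into `B` to be curried.
mutual
theorem redPrime_one : ∀ P : PrimeFormula V, RedPrime P [P] (one [P])
  | .letter p => by rw [RedPrime]; exact .letter p
  | .imp A B => by
    rw [RedPrime]
    refine ⟨ty_one _, fun Δ a ha => ?_⟩
    have hB : Red B (B ++ []) (one B) := by rw [List.append_nil]; exact .base (redTensor_one B)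
    have ha' : CutFree Δ A a :=
      LeftClosure.mem (CutFree.leftClosed A) (RedTensor.cutFree A) ha
    have := (Red.leftClosed B).left ha' hB
    rw [one_nil, mul_one, one_comp (ha'.ty.appl B)] at this
    exact this
theorem redTensor_one : ∀ A : List (PrimeFormula V), RedTensor A A (one A)
  | [] => by rw [RedTensor]; exact ⟨rfl, rfl⟩
  | P :: A => by
    rw [RedTensor]
    exact ⟨_, _, _, _, redPrime_one P, redTensor_one A, rfl, one_cons P A⟩
theorem RedPrime.cutFree : ∀ (P : PrimeFormula V) {Γ : Formula V} {f : Arr V},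
    RedPrime P Γ f → CutFree Γ [P] f
  | .letter p, Γ, f, h => by rw [RedPrime] at h; exact h
  | .imp A B, Γ, f, h => by
    rw [RedPrime] at h
    have h₁ := h.2 _ _ (.base (redTensor_one A))
    have h₂ : CutFree (A ++ Γ) B (eps A B ⊚ (one A * f)) :=
      LeftClosure.mem (CutFree.leftClosed B) (RedTensor.cutFree B) h₁
    have := h₂.curry
    rwa [curry_uncurry h.1] at this
theorem RedTensor.cutFree : ∀ (A : List (PrimeFormula V)) {Γ : Formula V} {f : Arr V},
    RedTensor A Γ f → CutFree Γ A f
  | [], Γ, f, h => by rw [RedTensor] at h; obtain ⟨rfl, rfl⟩ := h; exact .unit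
  | P :: A, Γ, f, h => by
    rw [RedTensor] at h
    obtain ⟨Γ₁, Γ₂, f₁, f₂, h₁, h₂, rfl, rfl⟩ := h
    exact .tensor (RedPrime.cutFree P h₁) (RedTensor.cutFree A h₂)
end

/-- Cut elimination. -/
theorem Arr.Ty.cutFree {A B : Formula V} {f : Arr V} (hf : f.Ty A B) : CutFree A B f := by
  induction f using Quotient.inductionOn with
  | h t =>
    have h : Red B A (mk t ⊚ one A) := Red.comp hf (.base (redTensor_one A))
    replace h : Red B A (mk t) := comp_one (f := mk t) hf ▸ h
    exact LeftClosure.mem (CutFree.leftClosed B) (RedTensor.cutFree B) h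

-- Signed occurrences and linear sequents

@[simp] theorem Formula.occs_nil : Formula.occs ([] : Formula V) = [] := by rw [Formula.occs]

@[simp] theorem Formula.occs_cons (P : PrimeFormula V) (A : Formula V) :
    Formula.occs (P :: A) = P.occs ++ Formula.occs A := by rw [Formula.occs]

@[simp] theorem Formula.occs_append (A B : Formula V) :
    Formula.occs (A ++ B) = Formula.occs A ++ Formula.occs B := by
  induction A with
  | nil => simp
  | cons P A ih => simp [ih]

theorem Formula.occs_eq_flatMap (A : Formula V) :
    Formula.occs A = A.flatMap PrimeFormula.occs := by
  induction A with
  | nil => simp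
  | cons P A ih => simp [ih]

/-- The signed occurrences in the antecedent `A` of an implication. -/
def Formula.negOccs (A : Formula V) : List (V × Bool) :=
  (Formula.occs A).map (fun x => (x.1, !x.2))

open Formula (negOccs)

@[simp] theorem Formula.negOccs_nil : negOccs ([] : Formula V) = [] := by simp [negOccs]

@[simp] theorem Formula.negOccs_append (A B : Formula V) :
    negOccs (A ++ B) = negOccs A ++ negOccs B := by simp [negOccs]

@[simp] theorem PrimeFormula.occs_letter (p : V) :
    (PrimeFormula.letter p).occs = [(p, true)] := by
  rw [PrimeFormula.occs]

@[simp] theorem PrimeFormula.occs_imp (A B : Formula V) :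
    (PrimeFormula.imp A B).occs = negOccs A ++ Formula.occs B := by
  rw [PrimeFormula.occs, negOccs]

@[simp] theorem Formula.negOccs_cons_letter (p : V) (Θ : Formula V) :
    negOccs (.letter p :: Θ) = (p, false) :: negOccs Θ := by
  simp [negOccs]

@[simp] theorem Formula.negOccs_cons_imp (A B Θ : Formula V) :
    negOccs (.imp A B :: Θ) = Formula.occs A ++ (negOccs B ++ negOccs Θ) := by
  simp [negOccs, Function.comp_def]

theorem Formula.mem_negOccs {A : Formula V} {p : V} {s : Bool} :
    (p, s) ∈ negOccs A ↔ (p, !s) ∈ Formula.occs A := by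
  simp only [negOccs, List.mem_map, Prod.mk.injEq, Prod.exists]
  constructor
  · rintro ⟨q, t, h, rfl, rfl⟩
    simpa using h
  · intro h
    exact ⟨p, !s, h, rfl, by simp⟩

theorem Formula.perm_negOccs {Γ Δ : Formula V} (h : Γ.Perm Δ) :
    (negOccs Γ).Perm (negOccs Δ) := by
  rw [negOccs, negOccs, Formula.occs_eq_flatMap, Formula.occs_eq_flatMap]
  exact (h.flatMap_right _).map _

/-- A sequent is linear when no letter has two occurrences of the same sign in it. -/
def Linear (Γ S : Formula V) : Prop := (negOccs Γ ++ Formula.occs S).Nodup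

theorem Linear.perm {Γ Δ S : Formula V} (h : Linear Γ S) (hΓ : Γ.Perm Δ) : Linear Δ S :=
  (((Formula.perm_negOccs hΓ).append_right _).nodup_iff).1 h

theorem Linear.of_append {Γ Δ S T : Formula V} (h : Linear (Γ ++ Δ) (S ++ T)) :
    Linear Γ S ∧ Linear Δ T := by
  simp only [Linear, Formula.negOccs_append, Formula.occs_append] at h ⊢
  exact ⟨h.sublist ((List.sublist_append_left ..).append (List.sublist_append_left ..)),
    h.sublist ((List.sublist_append_right ..).append (List.sublist_append_right ..))⟩

theorem Linear.uncurry {Γ A B : Formula V} (h : Linear Γ [.imp A B]) : Linear (A ++ Γ) B := by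
  simp only [Linear, Formula.negOccs_append, Formula.occs_cons, PrimeFormula.occs_imp,
    Formula.occs_nil, List.append_nil, ← List.append_assoc] at h ⊢
  exact ((List.perm_append_comm.append_right _).nodup_iff).1 h

theorem Linear.of_left {Δ A B Θ S : Formula V} (h : Linear (Δ ++ .imp A B :: Θ) S) :
    Linear Δ A ∧ Linear (B ++ Θ) S := by
  simp only [Linear, Formula.negOccs_append, Formula.negOccs_cons_imp] at h ⊢
  constructor
  · exact h.sublist (by simp)
  · exact h.sublist (by simp [← List.append_assoc])

/-- In a derivable sequent each letter that occurs does so with both signs. -/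
theorem CutFree.mem_occs {Γ S : Formula V} {f : Arr V} (h : CutFree Γ S f) (p : V) (s : Bool)
    (hp : (p, s) ∈ negOccs Γ ++ Formula.occs S) : (p, !s) ∈ negOccs Γ ++ Formula.occs S := by
  induction h generalizing s with
  | letter q => cases s <;> simp_all
  | unit => simp at hp
  | tensor _ _ ih₁ ih₂ =>
    have h₁ := ih₁ s
    have h₂ := ih₂ s
    simp only [Formula.negOccs_append, Formula.occs_append, List.mem_append] at hp h₁ h₂ ⊢
    tauto
  | curry _ ih =>
    have h₁ := ih s
    simp only [Formula.negOccs_append, Formula.occs_cons, Formula.occs_nil, List.append_nil,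
      PrimeFormula.occs_imp, List.mem_append] at hp h₁ ⊢
    tauto
  | left _ _ ih₁ ih₂ =>
    have h₁ := ih₁ s
    have h₂ := ih₂ s
    simp only [Formula.negOccs_append, Formula.negOccs_cons_imp, List.mem_append] at hp h₁ h₂ ⊢
    tauto
  | perm _ hσ ih =>
    have h₁ := ih s
    have e : ∀ x, x ∈ negOccs _ ↔ x ∈ negOccs _ := fun x =>
      (Formula.perm_negOccs hσ.perm).mem_iff
    simp only [List.mem_append, e] at hp h₁ ⊢
    exact h₁ hp

-- Reduced formulae and restriction of contexts to a set of letters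

/-- A prime formula is reduced when all implications in it have antecedent and consequent
different from `I`. -/
inductive PrimeFormula.Reduced : PrimeFormula V → Prop
  | letter (p : V) : Reduced (.letter p)
  | imp {A B : Formula V} : A ≠ [] → B ≠ [] → (∀ P ∈ A, Reduced P) → (∀ P ∈ B, Reduced P) →
      Reduced (.imp A B)

/-- A formula is reduced when its prime factors are. -/
def Formula.Reduced (A : Formula V) : Prop := ∀ P ∈ A, P.Reduced

@[simp] theorem Formula.reduced_append {A B : Formula V} :
    Formula.Reduced (A ++ B) ↔ Formula.Reduced A ∧ Formula.Reduced B := by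
  simp [Formula.Reduced, or_imp, forall_and]

@[simp] theorem Formula.reduced_cons {P : PrimeFormula V} {A : Formula V} :
    Formula.Reduced (P :: A) ↔ P.Reduced ∧ Formula.Reduced A := by
  simp [Formula.Reduced]

@[simp] theorem Formula.reduced_nil : Formula.Reduced ([] : Formula V) := by
  simp [Formula.Reduced]

@[simp] theorem PrimeFormula.reduced_imp {A B : Formula V} :
    (PrimeFormula.imp A B).Reduced ↔
      A ≠ [] ∧ B ≠ [] ∧ Formula.Reduced A ∧ Formula.Reduced B :=
  ⟨fun h => by cases h with | imp h₁ h₂ h₃ h₄ => exact ⟨h₁, h₂, h₃, h₄⟩,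
    fun h => .imp h.1 h.2.1 h.2.2.1 h.2.2.2⟩

theorem Formula.Reduced.perm {Γ Δ : Formula V} (h : Formula.Reduced Γ) (hΓ : Γ.Perm Δ) :
    Formula.Reduced Δ := fun P hP => h P (hΓ.mem_iff.2 hP)

theorem PrimeFormula.Reduced.occs_ne_nil {P : PrimeFormula V} (h : P.Reduced) :
    P.occs ≠ [] := by
  induction h with
  | letter p => simp
  | @imp A B _ hB _ _ _ ih =>
    obtain ⟨Q, B, rfl⟩ := List.exists_cons_of_ne_nil hB
    simp [ih Q (by simp)]

/-- A reduced factor contains a letter, so a repeated factor would repeat a signed occurrence. This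
is what makes `Str.unique` applicable to such contexts. -/
theorem Linear.nodup {Γ S : Formula V} (h : Linear Γ S) (hΓ : Formula.Reduced Γ) :
    Γ.Nodup := by
  have h₁ : (Formula.occs Γ).Nodup := (List.nodup_append.1 h).1.of_map
  rw [Formula.occs_eq_flatMap, List.nodup_flatMap] at h₁
  refine h₁.2.imp_of_mem fun {P Q} hP _ hPQ => ?_
  rintro rfl
  obtain ⟨x, hx⟩ := List.exists_mem_of_ne_nil _ (hΓ P hP).occs_ne_nil
  exact hPQ hx hx

/-- All letters of the prime formula `P` belong to `C`. -/
def PrimeFormula.On (C : Set V) (P : PrimeFormula V) : Prop := ∀ x ∈ P.occs, x.1 ∈ C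

/-- All letters of the formula `A` belong to `C`. -/
def Formula.On (C : Set V) (A : Formula V) : Prop := ∀ P ∈ A, P.On C

@[simp] theorem Formula.on_nil {C : Set V} : Formula.On C [] := by simp [Formula.On]

@[simp] theorem Formula.on_cons {C : Set V} {P : PrimeFormula V} {A : Formula V} :
    Formula.On C (P :: A) ↔ P.On C ∧ Formula.On C A := by simp [Formula.On]

@[simp] theorem Formula.on_append {C : Set V} {A B : Formula V} :
    Formula.On C (A ++ B) ↔ Formula.On C A ∧ Formula.On C B := by
  simp [Formula.On, or_imp, forall_and]

theorem Formula.on_iff {C : Set V} {A : Formula V} :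
    Formula.On C A ↔ ∀ x ∈ Formula.occs A, x.1 ∈ C := by
  induction A with
  | nil => simp
  | cons P A ih =>
    rw [Formula.on_cons, ih, Formula.occs_cons]
    simp only [List.mem_append, or_imp, forall_and]
    rfl

@[simp] theorem PrimeFormula.on_imp {C : Set V} {A B : Formula V} :
    (PrimeFormula.imp A B).On C ↔ Formula.On C A ∧ Formula.On C B := by
  rw [Formula.on_iff, Formula.on_iff]
  simp [PrimeFormula.On, negOccs, or_imp, forall_and]

theorem PrimeFormula.Reduced.not_on {C : Set V} {P : PrimeFormula V} (h : P.Reduced)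
    (h₁ : P.On C) : ¬ P.On Cᶜ := by
  obtain ⟨x, hx⟩ := List.exists_mem_of_ne_nil _ h.occs_ne_nil
  exact fun h₂ => h₂ x hx (h₁ x hx)

open Classical in
/-- The factors of `Γ` whose letters belong to `C`. -/
noncomputable def Formula.restrict (C : Set V) (Γ : Formula V) : Formula V :=
  Γ.filter (fun P => P.On C)

open Formula (restrict)

theorem Formula.mem_restrict {C : Set V} {Γ : Formula V} {P : PrimeFormula V} :
    P ∈ restrict C Γ ↔ P ∈ Γ ∧ P.On C := by simp [restrict]

@[simp] theorem Formula.restrict_append (C : Set V) (Γ Δ : Formula V) :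
    restrict C (Γ ++ Δ) = restrict C Γ ++ restrict C Δ := by simp [restrict]

theorem Formula.restrict_cons_of_on {C : Set V} {P : PrimeFormula V} (h : P.On C)
    (Γ : Formula V) : restrict C (P :: Γ) = P :: restrict C Γ := by simp [restrict, h]

theorem Formula.restrict_cons_of_not_on {C : Set V} {P : PrimeFormula V} (h : ¬ P.On C)
    (Γ : Formula V) : restrict C (P :: Γ) = restrict C Γ := by simp [restrict, h]

theorem Formula.restrict_eq_self {C : Set V} {Γ : Formula V} (h : Formula.On C Γ) :
    restrict C Γ = Γ := by
  rw [restrict, List.filter_eq_self]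
  exact fun P hP => by simpa using h P hP

theorem Formula.restrict_compl_eq_nil {C : Set V} {Γ : Formula V} (hΓ : Formula.Reduced Γ)
    (h : Formula.On C Γ) : restrict Cᶜ Γ = [] := by
  rw [restrict, List.filter_eq_nil_iff]
  intro P hP
  simpa using (hΓ P hP).not_on (h P hP)

theorem Formula.restrict_eq_nil {C : Set V} {Γ : Formula V} (hΓ : Formula.Reduced Γ)
    (h : Formula.On Cᶜ Γ) : restrict C Γ = [] := by
  have := Formula.restrict_compl_eq_nil hΓ h
  rwa [compl_compl] at this

theorem Formula.restrict_perm (C : Set V) {Γ Δ : Formula V} (h : Γ.Perm Δ) :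
    (restrict C Γ).Perm (restrict C Δ) := h.filter _

theorem Formula.Reduced.restrict {Γ : Formula V} (h : Formula.Reduced Γ) (C : Set V) :
    Formula.Reduced (restrict C Γ) := fun P hP => h P (Formula.mem_restrict.1 hP).1

/-- Every factor of `Γ` has all its letters in `C` or all its letters outside `C`. -/
def Formula.Bicolored (C : Set V) (Γ : Formula V) : Prop := ∀ P ∈ Γ, P.On C ∨ P.On Cᶜ

@[simp] theorem Formula.bicolored_append {C : Set V} {Γ Δ : Formula V} :
    Formula.Bicolored C (Γ ++ Δ) ↔ Formula.Bicolored C Γ ∧ Formula.Bicolored C Δ := by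
  simp [Formula.Bicolored, or_imp, forall_and]

@[simp] theorem Formula.bicolored_cons {C : Set V} {P : PrimeFormula V} {Γ : Formula V} :
    Formula.Bicolored C (P :: Γ) ↔ (P.On C ∨ P.On Cᶜ) ∧ Formula.Bicolored C Γ := by
  simp [Formula.Bicolored]

theorem Formula.On.bicolored {C : Set V} {Γ : Formula V} (h : Formula.On C Γ) :
    Formula.Bicolored C Γ := fun P hP => .inl (h P hP)

theorem Formula.On.bicolored_compl {C : Set V} {Γ : Formula V} (h : Formula.On Cᶜ Γ) :
    Formula.Bicolored C Γ := fun P hP => .inr (h P hP)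

theorem Formula.Bicolored.perm {C : Set V} {Γ Δ : Formula V} (h : Formula.Bicolored C Γ)
    (hΓ : Γ.Perm Δ) : Formula.Bicolored C Δ := fun P hP => h P (hΓ.mem_iff.2 hP)

theorem Formula.Bicolored.on_compl {C : Set V} {Γ : Formula V} (h : Formula.Bicolored C Γ)
    (e : restrict C Γ = []) : Formula.On Cᶜ Γ := fun P hP =>
  (h P hP).resolve_left fun h' => by
    have := Formula.mem_restrict.2 ⟨hP, h'⟩
    simp [e] at this

theorem Formula.Bicolored.on {C : Set V} {Γ : Formula V} (h : Formula.Bicolored C Γ)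
    (e : restrict Cᶜ Γ = []) : Formula.On C Γ := fun P hP =>
  (h P hP).resolve_right fun h' => by
    have := Formula.mem_restrict.2 ⟨hP, h'⟩
    simp [e] at this

theorem Formula.Bicolored.perm_append {C : Set V} {Γ : Formula V}
    (h : Formula.Bicolored C Γ) (hΓ : Formula.Reduced Γ) :
    Γ.Perm (restrict C Γ ++ restrict Cᶜ Γ) := by
  induction Γ with
  | nil => simp [restrict]
  | cons P Γ ih =>
    rw [Formula.bicolored_cons] at h
    rw [Formula.reduced_cons] at hΓ
    rcases h.1 with h₁ | h₁
    · rw [Formula.restrict_cons_of_on h₁, Formula.restrict_cons_of_not_on (hΓ.1.not_on h₁)]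
      exact (ih h.2 hΓ.2).cons P
    · rw [Formula.restrict_cons_of_on h₁,
        Formula.restrict_cons_of_not_on (fun h₂ => hΓ.1.not_on h₂ h₁)]
      exact ((ih h.2 hΓ.2).cons P).trans List.perm_middle.symm

/-- The letters of a derivable part of a linear sequent do not occur in the rest. -/
theorem CutFree.exists_on {Γ Δ S T : Formula V} {f : Arr V} (hf : CutFree Γ S f)
    (h : Linear (Γ ++ Δ) (S ++ T)) :
    ∃ C : Set V, Formula.On C Γ ∧ Formula.On C S ∧ Formula.On Cᶜ Δ ∧ Formula.On Cᶜ T := by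
  have hL : ∀ x ∈ negOccs Γ ++ Formula.occs S, ∀ y ∈ negOccs Δ ++ Formula.occs T, x ≠ y := by
    have : ((negOccs Γ ++ Formula.occs S) ++ (negOccs Δ ++ Formula.occs T)).Nodup := by
      refine (List.Perm.nodup_iff ?_).1 h
      simp only [Formula.negOccs_append, Formula.occs_append, List.append_assoc]
      refine List.Perm.append_left _ ?_
      simp only [← List.append_assoc]
      exact List.perm_append_comm.append_right _
    exact (List.nodup_append.1 this).2.2
  -- By `mem_occs` a letter of `Γ ⊢ S` already has both signs there, so any occurrence in the rest
  -- would be a repetition.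
  have key : ∀ p s t, (p, s) ∈ negOccs Γ ++ Formula.occs S →
      (p, t) ∈ negOccs Δ ++ Formula.occs T → False := by
    intro p s t hs ht
    by_cases e : s = t
    · subst e; exact hL _ hs _ ht rfl
    · have : t = !s := by cases s <;> cases t <;> simp_all
      subst this
      exact hL _ (hf.mem_occs p s hs) _ ht rfl
  refine ⟨{p | ∃ s, (p, s) ∈ negOccs Γ ++ Formula.occs S}, ?_, ?_, ?_, ?_⟩ <;>
    rw [Formula.on_iff] <;> rintro ⟨p, s⟩ hp
  · exact ⟨!s, List.mem_append_left _ (Formula.mem_negOccs.2 (by simpa using hp))⟩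
  · exact ⟨s, List.mem_append_right _ hp⟩
  · rintro ⟨t, ht⟩
    exact key p t (!s) ht (List.mem_append_left _ (Formula.mem_negOccs.2 (by simpa using hp)))
  · rintro ⟨t, ht⟩
    exact key p t s ht (List.mem_append_right _ hp)

/-- A left rule would leave the consequent `B` of an implication in a context that is empty by
induction, whereas `B ≠ []`. This is where the exclusion of `I` as a consequent matters. -/
theorem CutFree.eq_nil {Γ S : Formula V} {f : Arr V} (h : CutFree Γ S f) (hΓ : Formula.Reduced Γ)
    (hS : S = []) : Γ = [] := by
  induction h with
  | letter p => simp at hS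
  | unit => rfl
  | tensor _ _ ih₁ ih₂ =>
    rw [List.append_eq_nil_iff] at hS
    rw [Formula.reduced_append] at hΓ
    rw [ih₁ hΓ.1 hS.1, ih₂ hΓ.2 hS.2]; rfl
  | curry => simp at hS
  | left _ _ _ ih =>
    simp only [Formula.reduced_append, Formula.reduced_cons, PrimeFormula.reduced_imp] at hΓ
    have := ih (Formula.reduced_append.2 ⟨hΓ.2.1.2.2.2, hΓ.2.2⟩) hS
    exact absurd (List.append_eq_nil_iff.1 this).1 hΓ.2.1.2.1
  | perm _ hσ ih =>
    have := ih (hΓ.perm hσ.perm) hS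
    subst this
    exact hσ.perm.eq_nil

theorem CutFree.restrict_eq_nil {C : Set V} {Γ : Formula V} {f : Arr V}
    (h : CutFree (restrict C Γ) [] f) (hΓ : Formula.Reduced Γ) : restrict C Γ = [] :=
  h.eq_nil (hΓ.restrict C) rfl

-- Splitting an arrow along a set of letters

/-- Sliding two arrows acting on different factors past each other. -/
theorem Arr.slide {x y : Arr V} {A B C D : Formula V} (hx : x.Ty A B) (hy : y.Ty C D) :
    (one B * y) ⊚ (x * one C) = (x * one D) ⊚ (one A * y) := by
  rw [← mul_eq_left hx hy, ← mul_eq_right hx hy]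

/-- The arrow `f : Γ ⊢ S₁ ⊗ S₂` is up to exchange a tensor product of arrows, the source of the first
factor consisting of the factors of `Γ` whose letters belong to `C`. -/
def Splits (C : Set V) (Γ S₁ S₂ : Formula V) (f : Arr V) : Prop :=
  ∃ f₁ f₂ σ, CutFree (restrict C Γ) S₁ f₁ ∧ CutFree (restrict Cᶜ Γ) S₂ f₂ ∧
    Str Γ (restrict C Γ ++ restrict Cᶜ Γ) σ ∧ f = (f₁ * f₂) ⊚ σ

theorem CutFree.splits_of_on {C : Set V} {Γ S : Formula V} {f : Arr V} (h : CutFree Γ S f)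
    (hΓ : Formula.Reduced Γ) (hC : Formula.On C Γ) : Splits C Γ S [] f := by
  rw [Splits, Formula.restrict_eq_self hC, Formula.restrict_compl_eq_nil hΓ hC]
  exact ⟨f, 1, _, h, .unit, (Str.refl Γ).cast, by rw [mul_one, comp_one h.ty]⟩

theorem CutFree.splits_of_on_compl {C : Set V} {Γ S : Formula V} {f : Arr V} (h : CutFree Γ S f)
    (hΓ : Formula.Reduced Γ) (hC : Formula.On Cᶜ Γ) : Splits C Γ [] S f := by
  rw [Splits, Formula.restrict_eq_self hC, Formula.restrict_eq_nil hΓ hC]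
  exact ⟨1, f, _, .unit, h, (Str.refl Γ).cast, by rw [one_mul, comp_one h.ty]⟩

/-- Regrouping the four components requires the symmetry of `S'` and `T` on the target; it is an
identity because one of the two is `I`. -/
theorem Splits.tensor {C : Set V} {Γ Δ S S' T T' : Formula V} {f g : Arr V}
    (hf : Splits C Γ S S' f) (hg : Splits C Δ T T' g) (h : S' = [] ∨ T = []) :
    Splits C (Γ ++ Δ) (S ++ T) (S' ++ T') (f * g) := by
  obtain ⟨f₁, f₂, σ, hf₁, hf₂, hσ, rfl⟩ := hf
  obtain ⟨g₁, g₂, τ, hg₁, hg₂, hτ, rfl⟩ := hg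
  rw [Splits, Formula.restrict_append, Formula.restrict_append]
  have s₁ : Str (restrict C Γ ++ restrict Cᶜ Γ ++ (restrict C Δ ++ restrict Cᶜ Δ))
      (restrict C Γ ++ restrict C Δ ++ (restrict Cᶜ Γ ++ restrict Cᶜ Δ))
      (one (restrict C Γ) * (Arr.c (restrict Cᶜ Γ) (restrict C Δ) *
        one (restrict Cᶜ Δ))) :=
    (((Str.symmetry (restrict Cᶜ Γ) (restrict C Δ)).append_right (restrict Cᶜ Δ)).append_left
      (restrict C Γ)).cast
  refine ⟨f₁ * g₁, f₂ * g₂, _, hf₁.tensor hg₁, hf₂.tensor hg₂, (hσ.tensor hτ).trans s₁, ?_⟩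
  have e₁ : Arr.c S' T ⊚ (f₂ * g₁) = f₂ * g₁ := by
    have t := hf₂.ty.tensor hg₁.ty
    rcases h with rfl | rfl
    · rw [c_nil_left]; exact one_comp t
    · rw [c_nil_right]; exact one_comp (t.cast rfl)
  have e₂ : f₂ * g₁ = (g₁ * f₂) ⊚ Arr.c (restrict Cᶜ Γ) (restrict C Δ) := by
    rw [← e₁, c_nat hf₂.ty hg₁.ty]
  rw [← tensor_comp (hf₁.ty.tensor hf₂.ty) hσ.ty (hg₁.ty.tensor hg₂.ty) hτ.ty, ← comp_assoc]
  congr 1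
  calc f₁ * f₂ * (g₁ * g₂) = f₁ * ((f₂ * g₁) * g₂) := by simp only [mul_assoc]
    _ = (f₁ * (g₁ * f₂ * g₂)) ⊚ (one (restrict C Γ) *
        (Arr.c (restrict Cᶜ Γ) (restrict C Δ) * one (restrict Cᶜ Δ))) := by
      have t := (ty_c (restrict Cᶜ Γ) (restrict C Δ)).tensor (ty_one (restrict Cᶜ Δ))
      rw [tensor_comp hf₁.ty (ty_one _) ((hg₁.ty.tensor hf₂.ty).tensor hg₂.ty) t,
        tensor_comp (hg₁.ty.tensor hf₂.ty) (ty_c _ _) hg₂.ty (ty_one _), ← e₂,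
        comp_one hf₁.ty, comp_one hg₂.ty]
    _ = _ := by simp only [mul_assoc]

theorem Splits.perm {C : Set V} {Γ Γ' S T : Formula V} {f σ : Arr V} (hf : Splits C Γ S T f)
    (hσ : Str Γ' Γ σ) : Splits C Γ' S T (f ⊚ σ) := by
  obtain ⟨f₁, f₂, τ, hf₁, hf₂, hτ, rfl⟩ := hf
  obtain ⟨ρ₁, r₁⟩ := Str.exists_of_perm (Formula.restrict_perm C hσ.perm)
  obtain ⟨ρ₂, r₂⟩ := Str.exists_of_perm (Formula.restrict_perm Cᶜ hσ.perm)
  obtain ⟨ρ, r, -, e⟩ := (r₁.tensor r₂).exists_inv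
  refine ⟨f₁ ⊚ ρ₁, f₂ ⊚ ρ₂, _, hf₁.perm r₁, hf₂.perm r₂, (hσ.trans hτ).trans r, ?_⟩
  rw [← tensor_comp hf₁.ty r₁.ty hf₂.ty r₂.ty, comp_assoc, comp_assoc, ← comp_assoc (ρ₁ * ρ₂), e,
    one_comp (hτ.ty.comp hσ.ty rfl)]

/-- An arrow acting on the first factors commutes with a symmetry. -/
theorem Arr.symmetry_slide {x : Arr V} {A B : Formula V} (hx : x.Ty A B) (Γ Θ : Formula V) :
    (Arr.c B Γ * one Θ) ⊚ (x * one (Γ ++ Θ)) =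
      (one Γ * (x * one Θ)) ⊚ (Arr.c A Γ * one Θ) := by
  rw [← one_mul_one, ← mul_assoc, ← mul_one_comp (ty_c B Γ) (hx.tensor (ty_one Γ)),
    c_nat hx (ty_one Γ), mul_one_comp ((ty_one Γ).tensor hx) (ty_c A Γ), mul_assoc]

/-- The application is absorbed into the first component. By `Str.unique` the permutation splitting
`B ++ Θ` may be taken to fix `B`, so it slides past the application. -/
theorem Splits.left_of_on {C : Set V} {Δ A B Θ S T : Formula V} {k h : Arr V}
    (hk : CutFree Δ A k) (hh : Splits C (B ++ Θ) S T h) (hΔ : Formula.On C Δ)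
    (hP : (PrimeFormula.imp A B).On C) (hr : Formula.Reduced (Δ ++ .imp A B :: Θ))
    (hΘ : Formula.Bicolored C Θ) (nd : (B ++ Θ).Nodup) :
    Splits C (Δ ++ .imp A B :: Θ) S T (h ⊚ (k.appl A B * one Θ)) := by
  rw [Formula.reduced_append, Formula.reduced_cons] at hr
  have hB := (PrimeFormula.reduced_imp.1 hr.2.1).2.2.2
  have hCB := (PrimeFormula.on_imp.1 hP).2
  have tx := hk.ty.appl B
  obtain ⟨ρ, hρ⟩ := Str.exists_of_perm (hΘ.perm_append hr.2.2)
  obtain ⟨f₁, f₂, σ, hf₁, hf₂, hσ, rfl⟩ := hh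
  rw [Formula.restrict_append, Formula.restrict_eq_self hCB] at hf₁ hσ
  rw [Formula.restrict_append, Formula.restrict_compl_eq_nil hB hCB, List.nil_append] at hf₂ hσ
  obtain rfl := hσ.unique ((hρ.append_left B).cast) nd
  rw [Splits, Formula.restrict_append, Formula.restrict_append, Formula.restrict_cons_of_on hP,
    Formula.restrict_cons_of_not_on (hr.2.1.not_on hP), Formula.restrict_eq_self hΔ,
    Formula.restrict_compl_eq_nil hr.1 hΔ, List.nil_append]
  refine ⟨_, f₂, _, hk.left hf₁, hf₂, (hρ.append_left (Δ ++ [.imp A B])).cast, ?_⟩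
  rw [comp_assoc, slide tx hρ.ty, ← comp_assoc, ← one_mul_one (restrict C Θ), ← mul_assoc,
    tensor_comp hf₁.ty (tx.tensor (ty_one _)) hf₂.ty (ty_one _), comp_one hf₂.ty]

theorem Splits.left_of_on_compl {C : Set V} {Δ A B Θ S T : Formula V} {k h : Arr V}
    (hk : CutFree Δ A k) (hh : Splits C (B ++ Θ) S T h) (hΔ : Formula.On Cᶜ Δ)
    (hP : (PrimeFormula.imp A B).On Cᶜ) (hr : Formula.Reduced (Δ ++ .imp A B :: Θ))
    (hΘ : Formula.Bicolored C Θ) (nd : (B ++ Θ).Nodup) :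
    Splits C (Δ ++ .imp A B :: Θ) S T (h ⊚ (k.appl A B * one Θ)) := by
  rw [Formula.reduced_append, Formula.reduced_cons] at hr
  have hB := (PrimeFormula.reduced_imp.1 hr.2.1).2.2.2
  have hCB := (PrimeFormula.on_imp.1 hP).2
  have tx := hk.ty.appl B
  obtain ⟨ρ, hρ⟩ := Str.exists_of_perm (hΘ.perm_append hr.2.2)
  obtain ⟨f₁, f₂, σ, hf₁, hf₂, hσ, rfl⟩ := hh
  rw [Formula.restrict_append, Formula.restrict_eq_nil hB hCB, List.nil_append] at hf₁ hσ
  rw [Formula.restrict_append, Formula.restrict_eq_self hCB] at hf₂ hσ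
  have s : ∀ A : Formula V, Str (A ++ Θ) (restrict C Θ ++ (A ++ restrict Cᶜ Θ))
      ((Arr.c A (restrict C Θ) * one (restrict Cᶜ Θ)) ⊚ (one A * ρ)) := fun A =>
    (hρ.append_left A).trans (((Str.symmetry A _).append_right _).cast)
  obtain rfl := hσ.unique (s B) nd
  rw [Splits, Formula.restrict_append, Formula.restrict_append, Formula.restrict_cons_of_on hP,
    Formula.restrict_cons_of_not_on (fun h' => hr.2.1.not_on h' hP), Formula.restrict_eq_self hΔ,
    Formula.restrict_eq_nil hr.1 hΔ, List.nil_append]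
  refine ⟨f₁, _, _, hf₁, hk.left hf₂, (s (Δ ++ [.imp A B])).cast, ?_⟩
  rw [comp_assoc, comp_assoc, slide tx hρ.ty, ← comp_assoc (Arr.c B _ * _), symmetry_slide tx,
    ← comp_assoc, ← comp_assoc, ← comp_assoc,
    tensor_comp hf₁.ty (ty_one _) hf₂.ty (tx.tensor (ty_one _)), comp_one hf₁.ty, comp_assoc]

/-- If the letters of the factors of a derivable reduced linear sequent are of two disjoint kinds,
each factor having letters of one kind only, then the arrow splits accordingly. -/
theorem CutFree.splits {Γ S : Formula V} {f : Arr V} (h : CutFree Γ S f) (C : Set V)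
    {S₁ S₂ : Formula V} (hΓ : Formula.Reduced Γ) (hS : Formula.Reduced S) (hL : Linear Γ S)
    (hC : Formula.Bicolored C Γ) (e : S = S₁ ++ S₂) (h₁ : Formula.On C S₁)
    (h₂ : Formula.On Cᶜ S₂) : Splits C Γ S₁ S₂ f := by
  induction h generalizing S₁ S₂ with
  | letter p =>
    rcases List.append_eq_singleton_iff.1 e.symm with ⟨rfl, rfl⟩ | ⟨rfl, rfl⟩
    · exact (CutFree.letter p).splits_of_on_compl hΓ h₂
    · exact (CutFree.letter p).splits_of_on hΓ h₁
  | unit =>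
    obtain ⟨rfl, rfl⟩ := List.append_eq_nil_iff.1 e.symm
    exact CutFree.unit.splits_of_on hΓ (by simp)
  | @tensor Γ Δ S T f g hf hg ihf ihg =>
    rw [Formula.reduced_append] at hΓ hS
    rw [Formula.bicolored_append] at hC
    obtain ⟨hL₁, hL₂⟩ := hL.of_append
    -- The boundary between `S₁` and `S₂` falls inside at most one of `S` and `T`, so one of the two
    -- middle pieces is `I`, as `Splits.tensor` demands.
    rcases List.append_eq_append_iff.1 e with ⟨X, rfl, rfl⟩ | ⟨X, rfl, rfl⟩
    · rw [Formula.on_append] at h₁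
      exact (ihf hΓ.1 hS.1 hL₁ hC.1 (List.append_nil S).symm h₁.1 (by simp)).tensor
        (ihg hΓ.2 hS.2 hL₂ hC.2 rfl h₁.2 h₂) (.inl rfl)
    · rw [Formula.on_append] at h₂
      simpa using (ihf hΓ.1 hS.1 hL₁ hC.1 rfl h₁ h₂.1).tensor
        (ihg hΓ.2 hS.2 hL₂ hC.2 (List.nil_append T).symm (by simp) h₂.2) (.inr rfl)
  | @curry A Γ B f hf ih =>
    simp only [Formula.reduced_cons, PrimeFormula.reduced_imp] at hS
    have hΓ' : Formula.Reduced (A ++ Γ) := Formula.reduced_append.2 ⟨hS.1.2.2.1, hΓ⟩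
    rcases List.append_eq_singleton_iff.1 e.symm with ⟨rfl, rfl⟩ | ⟨rfl, rfl⟩
    · simp only [Formula.on_cons, PrimeFormula.on_imp] at h₂
      have hC' := Formula.bicolored_append.2 ⟨h₂.1.1.bicolored_compl, hC⟩
      -- The induction hypothesis makes the factors on `C` derive `I`, so there are none.
      obtain ⟨f₁, f₂, σ, hf₁, -⟩ :=
        ih hΓ' hS.1.2.2.2 hL.uncurry hC' (List.nil_append B).symm (by simp) h₂.1.2
      have := hC'.on_compl (hf₁.restrict_eq_nil hΓ')
      exact hf.curry.splits_of_on_compl hΓ (Formula.on_append.1 this).2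
    · simp only [Formula.on_cons, PrimeFormula.on_imp] at h₁
      have hC' := Formula.bicolored_append.2 ⟨h₁.1.1.bicolored, hC⟩
      obtain ⟨f₁, f₂, σ, -, hf₂, -⟩ :=
        ih hΓ' hS.1.2.2.2 hL.uncurry hC' (List.append_nil B).symm h₁.1.2 (by simp)
      have := hC'.on (hf₂.restrict_eq_nil hΓ')
      exact hf.curry.splits_of_on hΓ (Formula.on_append.1 this).2
  | @left A B Δ Θ S k h hk hh ihk ih =>
    subst e
    have hΓ' := hΓ
    simp only [Formula.reduced_append, Formula.reduced_cons, PrimeFormula.reduced_imp] at hΓ'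
    obtain ⟨hΔ, ⟨-, -, hA, hB⟩, hΘ⟩ := hΓ'
    simp only [Formula.bicolored_append, Formula.bicolored_cons, PrimeFormula.on_imp] at hC
    obtain ⟨hCΔ, hCP, hCΘ⟩ := hC
    obtain ⟨hL₁, hL₂⟩ := hL.of_left
    have hBΘ : Formula.Reduced (B ++ Θ) := Formula.reduced_append.2 ⟨hB, hΘ⟩
    have nd := hL₂.nodup hBΘ
    -- The implication has one colour; splitting the argument `k` against `I` shows that all of `Δ`
    -- has the same colour.
    rcases hCP with hP | hP
    · obtain ⟨_, _, _, -, hk₂, -⟩ :=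
        ihk hΔ hA hL₁ hCΔ (List.append_nil A).symm hP.1 (by simp)
      exact (ih hBΘ hS hL₂ (Formula.bicolored_append.2 ⟨hP.2.bicolored, hCΘ⟩) rfl h₁ h₂).left_of_on
        hk (hCΔ.on (hk₂.restrict_eq_nil hΔ)) (PrimeFormula.on_imp.2 hP) hΓ hCΘ nd
    · obtain ⟨_, _, _, hk₁, -⟩ :=
        ihk hΔ hA hL₁ hCΔ (List.nil_append A).symm (by simp) hP.1
      exact (ih hBΘ hS hL₂ (Formula.bicolored_append.2 ⟨hP.2.bicolored_compl, hCΘ⟩) rfl h₁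
        h₂).left_of_on_compl hk (hCΔ.on_compl (hk₁.restrict_eq_nil hΔ)) (PrimeFormula.on_imp.2 hP)
        hΓ hCΘ nd
  | @perm Γ Γ' S f σ hf hσ ih =>
    exact (ih (hΓ.perm hσ.perm) hS (hL.perm hσ.perm) (hC.perm hσ.perm) e h₁ h₂).perm hσ

-- Inverting the left rule for implication

theorem Arr.appl_comp {k x : Arr V} {Γ Δ A : Formula V} (hk : k.Ty Γ A) (hx : x.Ty Δ Γ)
    (B : Formula V) : (k ⊚ x).appl A B = k.appl A B ⊚ (x * one [.imp A B]) := by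
  rw [appl, mul_one_comp hk hx, ← comp_assoc]
  rfl

theorem Arr.symmetry_slide' {x : Arr V} {A B : Formula V} (hx : x.Ty A B) (Γ Θ : Formula V) :
    (x * one (Γ ++ Θ)) ⊚ (Arr.c Γ A * one Θ) =
      (Arr.c Γ B * one Θ) ⊚ (one Γ * (x * one Θ)) := by
  rw [← one_mul_one, ← mul_assoc, ← mul_assoc,
    ← mul_one_comp (hx.tensor (ty_one Γ)) (ty_c Γ A), ← c_nat (ty_one Γ) hx,
    mul_one_comp (ty_c Γ B) ((ty_one Γ).tensor hx)]

/-- The arrow `f : Γ ⊢ S` is up to exchange obtained by the left rule for `A → B`, the argument using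
the factors of `Γ` whose letters belong to `C`, and the rest those whose letters do not. -/
def Inverts (C : Set V) (A B Γ S : Formula V) (f : Arr V) : Prop :=
  ∃ k h σ, CutFree (restrict C Γ) A k ∧ CutFree (B ++ restrict Cᶜ Γ) S h ∧
    Str Γ (restrict C Γ ++ .imp A B :: restrict Cᶜ Γ) σ ∧
    f = h ⊚ (k.appl A B * one (restrict Cᶜ Γ)) ⊚ σ

section
variable {C : Set V} {A B : Formula V}

theorem PrimeFormula.Reduced.not_on_imp (hP : (PrimeFormula.imp A B).Reduced)
    (hB : Formula.On Cᶜ B) : ¬ (PrimeFormula.imp A B).On C := by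
  intro h
  rw [PrimeFormula.on_imp] at h
  rw [PrimeFormula.reduced_imp] at hP
  obtain ⟨Q, hQ⟩ := List.exists_mem_of_ne_nil _ hP.2.1
  exact (hP.2.2.2 Q hQ).not_on (h.2 Q hQ) (hB Q hQ)

theorem PrimeFormula.Reduced.not_on_compl_imp (hP : (PrimeFormula.imp A B).Reduced)
    (hA : Formula.On C A) : ¬ (PrimeFormula.imp A B).On Cᶜ := by
  intro h
  rw [PrimeFormula.on_imp] at h
  rw [PrimeFormula.reduced_imp] at hP
  obtain ⟨Q, hQ⟩ := List.exists_mem_of_ne_nil _ hP.1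
  exact (hP.2.2.1 Q hQ).not_on (hA Q hQ) (h.1 Q hQ)

theorem Inverts.of_left {Δ Θ S : Formula V} {k h : Arr V} (hk : CutFree Δ A k)
    (hh : CutFree (B ++ Θ) S h) (hr : Formula.Reduced (Δ ++ .imp A B :: Θ))
    (hA : Formula.On C A) (hB : Formula.On Cᶜ B) (hΔ : Formula.On C Δ) (hΘ : Formula.On Cᶜ Θ) :
    Inverts C A B (Δ ++ .imp A B :: Θ) S (h ⊚ (k.appl A B * one Θ)) := by
  rw [Formula.reduced_append, Formula.reduced_cons] at hr
  rw [Inverts, Formula.restrict_append, Formula.restrict_append,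
    Formula.restrict_cons_of_not_on (hr.2.1.not_on_imp hB),
    Formula.restrict_cons_of_not_on (hr.2.1.not_on_compl_imp hA),
    Formula.restrict_eq_self hΔ, Formula.restrict_eq_self hΘ,
    Formula.restrict_eq_nil hr.2.2 hΘ, Formula.restrict_compl_eq_nil hr.1 hΔ, List.append_nil,
    List.nil_append]
  refine ⟨k, h, _, hk, hh, Str.refl _, ?_⟩
  rw [comp_one (hk.ty.appl_mul_one B Θ)]

theorem Inverts.tensor_left {Γ Δ S T : Formula V} {f g : Arr V} (hf : Inverts C A B Γ S f)
    (hg : CutFree Δ T g) (hΔ : Formula.On Cᶜ Δ) (hr : Formula.Reduced Δ) :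
    Inverts C A B (Γ ++ Δ) (S ++ T) (f * g) := by
  obtain ⟨k, h, σ, hk, hh, hσ, rfl⟩ := hf
  rw [Inverts, Formula.restrict_append, Formula.restrict_append,
    Formula.restrict_eq_self hΔ, Formula.restrict_eq_nil hr hΔ, List.append_nil]
  refine ⟨k, h * g, _, hk, ?_, (hσ.append_right Δ).cast, ?_⟩
  · rw [← List.append_assoc]; exact hh.tensor hg
  · have tx := hk.ty.appl_mul_one B (restrict Cᶜ Γ)
    rw [← one_mul_one, ← mul_assoc, ← mul_one_comp tx hσ.ty,
      tensor_comp hh.ty (tx.comp hσ.ty rfl) hg.ty (ty_one Δ), comp_one hg.ty]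

theorem Inverts.tensor_right {Γ Δ S T : Formula V} {f g : Arr V} (hf : CutFree Γ S f)
    (hg : Inverts C A B Δ T g) (hΓ : Formula.On Cᶜ Γ) (hr : Formula.Reduced Γ) :
    Inverts C A B (Γ ++ Δ) (S ++ T) (f * g) := by
  obtain ⟨k, h, σ, hk, hh, hσ, rfl⟩ := hg
  rw [Inverts, Formula.restrict_append, Formula.restrict_append,
    Formula.restrict_eq_self hΓ, Formula.restrict_eq_nil hr hΓ, List.nil_append]
  have s₁ : Str (B ++ (Γ ++ restrict Cᶜ Δ)) (Γ ++ (B ++ restrict Cᶜ Δ))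
      (Arr.c B Γ * one (restrict Cᶜ Δ)) := ((Str.symmetry B Γ).append_right _).cast
  have s₂ : Str (Γ ++ Δ) (restrict C Δ ++ .imp A B :: (Γ ++ restrict Cᶜ Δ))
      ((Arr.c Γ (restrict C Δ ++ [.imp A B]) * one (restrict Cᶜ Δ)) ⊚ (one Γ * σ)) :=
    (hσ.append_left Γ).trans (((Str.symmetry Γ _).append_right _).cast)
  refine ⟨k, (f * h) ⊚ (Arr.c B Γ * one (restrict Cᶜ Δ)), _, hk, (hf.tensor hh).perm s₁, s₂, ?_⟩
  have tx := hk.ty.appl_mul_one B (restrict Cᶜ Δ)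
  have e := one_mul_mul_one (hk.ty.appl B) Γ (restrict Cᶜ Δ)
  rw [comp_assoc, ← comp_assoc (_ * one (Γ ++ _)), ← comp_assoc (Arr.c B Γ * _), ← e,
    ← one_mul_comp tx hσ.ty, tensor_comp hf.ty (ty_one Γ) hh.ty (tx.comp hσ.ty rfl),
    comp_one hf.ty]

/-- The discharged `A'` lies outside `C`, so the argument of `A → B` does not use it, and naturality
of currying moves the application outside. Distinctness of the factors allows a permutation that
acts on `Γ` alone, up to moving `A'` aside. -/
theorem Inverts.curry {Γ A' B' : Formula V} {f : Arr V} (hf : Inverts C A B (A' ++ Γ) B' f)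
    (hA' : Formula.On Cᶜ A') (hr : Formula.Reduced A') (nd : (A' ++ Γ).Nodup)
    (hΓ : Γ.Perm (restrict C Γ ++ .imp A B :: restrict Cᶜ Γ)) :
    Inverts C A B Γ [.imp A' B'] (f.curry A' Γ) := by
  obtain ⟨k, h, τ, hk, hh, hτ, rfl⟩ := hf
  obtain ⟨σ, hσ⟩ := Str.exists_of_perm hΓ
  rw [Formula.restrict_append, Formula.restrict_eq_nil hr hA', List.nil_append] at hk hτ
  rw [Formula.restrict_append, Formula.restrict_eq_self hA'] at hh hτ ⊢
  have s₂ : Str (A' ++ Γ) (restrict C Γ ++ .imp A B :: (A' ++ restrict Cᶜ Γ))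
      ((Arr.c A' (restrict C Γ ++ [.imp A B]) * one (restrict Cᶜ Γ)) ⊚ (one A' * σ)) :=
    (hσ.append_left A').trans (((Str.symmetry A' _).append_right _).cast)
  have s₁ : Str (A' ++ (B ++ restrict Cᶜ Γ)) (B ++ (A' ++ restrict Cᶜ Γ))
      (Arr.c A' B * one (restrict Cᶜ Γ)) := ((Str.symmetry A' B).append_right _).cast
  obtain rfl := hτ.unique s₂ nd
  have hh' := hh.perm s₁
  refine ⟨k, _, σ, hk, hh'.curry, hσ, ?_⟩
  have tx := hk.ty.appl_mul_one B (restrict Cᶜ Γ)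
  rw [← comp_assoc (_ * one (A' ++ _)), symmetry_slide' (hk.ty.appl B), comp_assoc,
    ← one_mul_comp tx hσ.ty, ← comp_assoc, curry_comp hh'.ty (tx.comp hσ.ty rfl)]

/-- The rule for `X → Y` becomes part of the argument supplied to `A → B`. -/
theorem Inverts.left_of_on {Δ X Y Θ S : Formula V} {k₀ h₀ : Arr V} (hk₀ : CutFree Δ X k₀)
    (hh₀ : Inverts C A B (Y ++ Θ) S h₀) (hΔ : Formula.On C Δ)
    (hQ : (PrimeFormula.imp X Y).On C) (hr : Formula.Reduced (Δ ++ .imp X Y :: Θ))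
    (nd : (Y ++ Θ).Nodup) (hΘ : Θ.Perm (restrict C Θ ++ .imp A B :: restrict Cᶜ Θ)) :
    Inverts C A B (Δ ++ .imp X Y :: Θ) S (h₀ ⊚ (k₀.appl X Y * one Θ)) := by
  rw [Formula.reduced_append, Formula.reduced_cons] at hr
  have hY := (PrimeFormula.reduced_imp.1 hr.2.1).2.2.2
  have hCY := (PrimeFormula.on_imp.1 hQ).2
  obtain ⟨σ, hσ⟩ := Str.exists_of_perm hΘ
  obtain ⟨k, h, τ, hk, hh, hτ, rfl⟩ := hh₀
  rw [Formula.restrict_append, Formula.restrict_eq_self hCY] at hk hτ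
  rw [Formula.restrict_append, Formula.restrict_compl_eq_nil hY hCY, List.nil_append] at hh hτ ⊢
  obtain rfl := hτ.unique ((hσ.append_left Y).cast) nd
  rw [Inverts, Formula.restrict_append, Formula.restrict_append, Formula.restrict_cons_of_on hQ,
    Formula.restrict_cons_of_not_on (hr.2.1.not_on hQ), Formula.restrict_eq_self hΔ,
    Formula.restrict_compl_eq_nil hr.1 hΔ, List.nil_append]
  refine ⟨_, h, _, hk₀.left hk, hh, (hσ.append_left (Δ ++ [.imp X Y])).cast, ?_⟩
  have ty := hk₀.ty.appl Y
  have tk := hk.ty.appl B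
  rw [comp_assoc, comp_assoc, slide ty hσ.ty, ← comp_assoc (_ * one (restrict Cᶜ Θ)),
    appl_comp hk.ty (hk₀.ty.appl_mul_one Y (restrict C Θ)) B, mul_one_comp tk
    ((hk₀.ty.appl_mul_one Y (restrict C Θ)).tensor (ty_one _))]
  simp only [mul_assoc, one_mul_one, List.append_assoc, List.cons_append, List.nil_append]

/-- The two left rules act on disjoint groups of factors and commute; the one for `X → Y` goes into
the remainder. -/
theorem Inverts.left_of_on_compl {Δ X Y Θ S : Formula V} {k₀ h₀ : Arr V} (hk₀ : CutFree Δ X k₀)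
    (hh₀ : Inverts C A B (Y ++ Θ) S h₀) (hΔ : Formula.On Cᶜ Δ)
    (hQ : (PrimeFormula.imp X Y).On Cᶜ) (hr : Formula.Reduced (Δ ++ .imp X Y :: Θ))
    (nd : (Y ++ Θ).Nodup) (hΘ : Θ.Perm (restrict C Θ ++ .imp A B :: restrict Cᶜ Θ)) :
    Inverts C A B (Δ ++ .imp X Y :: Θ) S (h₀ ⊚ (k₀.appl X Y * one Θ)) := by
  rw [Formula.reduced_append, Formula.reduced_cons] at hr
  have hY := (PrimeFormula.reduced_imp.1 hr.2.1).2.2.2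
  have hCY := (PrimeFormula.on_imp.1 hQ).2
  obtain ⟨σ, hσ⟩ := Str.exists_of_perm hΘ
  obtain ⟨k, h, τ, hk, hh, hτ, rfl⟩ := hh₀
  rw [Formula.restrict_append, Formula.restrict_eq_nil hY hCY, List.nil_append] at hk hτ
  rw [Formula.restrict_append, Formula.restrict_eq_self hCY] at hh hτ ⊢
  have s : ∀ Y : Formula V, Str (Y ++ Θ) (restrict C Θ ++ .imp A B :: (Y ++ restrict Cᶜ Θ))
      ((Arr.c Y (restrict C Θ ++ [.imp A B]) * one (restrict Cᶜ Θ)) ⊚ (one Y * σ)) := fun Y =>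
    (hσ.append_left Y).trans (((Str.symmetry Y _).append_right _).cast)
  obtain rfl := hτ.unique (s Y) nd
  rw [Inverts, Formula.restrict_append, Formula.restrict_append, Formula.restrict_cons_of_on hQ,
    Formula.restrict_cons_of_not_on (fun h' => hr.2.1.not_on h' hQ), Formula.restrict_eq_self hΔ,
    Formula.restrict_eq_nil hr.1 hΔ, List.nil_append]
  refine ⟨k, _, _, hk, (CutFree.leftClosed S).left_middle hk₀ hh, (s (Δ ++ [.imp X Y])).cast, ?_⟩
  have ty := hk₀.ty.appl Y
  have ty' := hk₀.ty.appl_mul_one Y (restrict Cᶜ Θ)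
  have tk := hk.ty.appl B
  have e : one (restrict C Θ ++ .imp A B :: restrict Cᶜ Θ) =
    one (restrict C Θ ++ [.imp A B] ++ restrict Cᶜ Θ) := by simp
  rw [comp_assoc, comp_assoc, comp_assoc, slide ty hσ.ty, e, ← comp_assoc (Arr.c Y _ * _),
    symmetry_slide ty, comp_assoc, comp_assoc, ← comp_assoc (one B * _), slide tk ty', comp_assoc]

/-- The rule for `A → B` used inside the argument of `X → Y` is performed before the application of
`X → Y` instead. -/
theorem Inverts.left_argument {Δ X Y Θ S : Formula V} {k₀ h₀ : Arr V}
    (hk₀ : Inverts C A B Δ X k₀) (hh₀ : CutFree (Y ++ Θ) S h₀) (hΘ : Formula.On Cᶜ Θ)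
    (hQ : (PrimeFormula.imp X Y).On Cᶜ) (hr : Formula.Reduced (.imp X Y :: Θ)) :
    Inverts C A B (Δ ++ .imp X Y :: Θ) S (h₀ ⊚ (k₀.appl X Y * one Θ)) := by
  obtain ⟨k, h, σ, hk, hh, hσ, rfl⟩ := hk₀
  have hQΘ : Formula.On Cᶜ (.imp X Y :: Θ) := Formula.on_cons.2 ⟨hQ, hΘ⟩
  rw [Inverts, Formula.restrict_append, Formula.restrict_append, Formula.restrict_eq_nil hr hQΘ,
    Formula.restrict_eq_self hQΘ, List.append_nil]
  refine ⟨k, h₀ ⊚ (h.appl X Y * one Θ), _, hk, ?_, (hσ.append_right (.imp X Y :: Θ)).cast, ?_⟩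
  · rw [← List.append_assoc]; exact hh.left hh₀
  · have tx := hk.ty.appl_mul_one B (restrict Cᶜ Δ)
    rw [appl_comp hh.ty (tx.comp hσ.ty rfl), comp_assoc,
      mul_one_comp (hh.ty.appl Y) ((tx.comp hσ.ty rfl).tensor (ty_one _)), mul_assoc, one_mul_one,
      mul_one_comp tx hσ.ty, mul_assoc, one_mul_one]
    rfl

theorem Inverts.perm {Γ Γ' S : Formula V} {f σ : Arr V} (hf : Inverts C A B Γ S f)
    (hσ : Str Γ' Γ σ) : Inverts C A B Γ' S (f ⊚ σ) := by
  obtain ⟨k, h, τ, hk, hh, hτ, rfl⟩ := hf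
  obtain ⟨ρ₁, r₁⟩ := Str.exists_of_perm (Formula.restrict_perm C hσ.perm)
  obtain ⟨ρ₂, r₂⟩ := Str.exists_of_perm (Formula.restrict_perm Cᶜ hσ.perm)
  obtain ⟨ρ, r, -, e⟩ := (r₁.tensor (r₂.cons (.imp A B))).exists_inv
  refine ⟨k ⊚ ρ₁, h ⊚ (one B * ρ₂), _, hk.perm r₁, hh.perm (r₂.append_left B),
    (hσ.trans hτ).trans r, ?_⟩
  have tk := hk.ty.appl B
  have e₁ : (one B * ρ₂) ⊚ ((k ⊚ ρ₁).appl A B * one (restrict Cᶜ Γ')) =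
      (k.appl A B * one (restrict Cᶜ Γ)) ⊚ (ρ₁ * (one [.imp A B] * ρ₂)) := by
    have t := r₁.ty.tensor (ty_one [.imp A B])
    rw [appl_comp hk.ty r₁.ty, slide (tk.comp t rfl) r₂.ty, mul_one_comp tk t, comp_assoc,
      ← mul_eq_left t r₂.ty, mul_assoc]
  simp only [comp_assoc]
  rw [← comp_assoc (one B * ρ₂), e₁]
  simp only [comp_assoc]
  rw [← comp_assoc (ρ₁ * _), e, one_comp (hτ.ty.comp hσ.ty rfl)]

end

section
variable {C : Set V} {A B : Formula V}

theorem Formula.bicolored_of_not_mem {Γ : Formula V}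
    (hC : ∀ Q ∈ Γ, Q = .imp A B ∨ Q.On C ∨ Q.On Cᶜ) (h : PrimeFormula.imp A B ∉ Γ) :
    Formula.Bicolored C Γ := fun Q hQ =>
  (hC Q hQ).resolve_left fun e => h (e ▸ hQ)

theorem Formula.perm_restrict_append {Γ : Formula V} (hr : Formula.Reduced Γ) (nd : Γ.Nodup)
    (hP : PrimeFormula.imp A B ∈ Γ) (hA : Formula.On C A) (hB : Formula.On Cᶜ B)
    (hC : ∀ Q ∈ Γ, Q = .imp A B ∨ Q.On C ∨ Q.On Cᶜ) :
    Γ.Perm (restrict C Γ ++ .imp A B :: restrict Cᶜ Γ) := by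
  obtain ⟨X, Y, rfl⟩ := List.append_of_mem hP
  have hPr := hr _ hP
  have nd' := List.perm_middle.nodup_iff.1 nd
  have hb : Formula.Bicolored C (X ++ Y) := Formula.bicolored_of_not_mem
    (fun Q hQ => hC Q (by simp only [List.mem_append, List.mem_cons] at hQ ⊢; tauto))
    (List.nodup_cons.1 nd').1
  have e : ∀ {D : Set V}, ¬ (PrimeFormula.imp A B).On D →
      restrict D (X ++ .imp A B :: Y) = restrict D (X ++ Y) := fun h => by
    rw [Formula.restrict_append, Formula.restrict_cons_of_not_on h, ← Formula.restrict_append]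
  rw [e (hPr.not_on_imp hB), e (hPr.not_on_compl_imp hA)]
  refine List.perm_middle.trans (List.Perm.trans ?_ List.perm_middle.symm)
  refine (hb.perm_append ?_).cons _
  simp only [Formula.reduced_append, Formula.reduced_cons] at hr ⊢
  exact ⟨hr.1, hr.2.2⟩

/-- Inversion of the left rule: if the letters of `A` belong to `C`, those of `B` and `S` do not, and
the other factors of `Γ` have letters of one of the two kinds only, then every derivation of
`Γ ⊢ S` can be arranged to end with the left rule for `A → B`. -/
theorem CutFree.inverts {Γ S : Formula V} {f : Arr V} (h : CutFree Γ S f)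
    (hA : Formula.On C A) (hB : Formula.On Cᶜ B) (hΓ : Formula.Reduced Γ)
    (hS : Formula.Reduced S) (hL : Linear Γ S) (hCS : Formula.On Cᶜ S)
    (hP : PrimeFormula.imp A B ∈ Γ) (hC : ∀ Q ∈ Γ, Q = .imp A B ∨ Q.On C ∨ Q.On Cᶜ) :
    Inverts C A B Γ S f := by
  induction h with
  | letter p => simp at hP
  | unit => simp at hP
  | @tensor Γ Δ S T f g hf hg ihf ihg =>
    have nd := hL.nodup hΓ
    rw [Formula.reduced_append] at hΓ hS
    rw [Formula.on_append] at hCS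
    obtain ⟨hL₁, hL₂⟩ := hL.of_append
    have hC₁ := fun Q hQ => hC Q (List.mem_append_left Δ hQ)
    have hC₂ := fun Q hQ => hC Q (List.mem_append_right Γ hQ)
    have dj := List.disjoint_of_nodup_append nd
    -- Only one tensor factor has `A → B` in its source. The other splits with `I` as its `C`-part,
    -- so its source avoids `C`.
    by_cases hP₁ : PrimeFormula.imp A B ∈ Γ
    · have hb := Formula.bicolored_of_not_mem hC₂ (dj hP₁)
      obtain ⟨_, _, _, hg₁, -⟩ := hg.splits C hΓ.2 hS.2 hL₂ hb (List.nil_append T).symm (by simp)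
        hCS.2
      exact (ihf hΓ.1 hS.1 hL₁ hCS.1 hP₁ hC₁).tensor_left hg
        (hb.on_compl (hg₁.restrict_eq_nil hΓ.2)) hΓ.2
    · have hb := Formula.bicolored_of_not_mem hC₁ hP₁
      obtain ⟨_, _, _, hf₁, -⟩ := hf.splits C hΓ.1 hS.1 hL₁ hb (List.nil_append S).symm (by simp)
        hCS.1
      exact (ihg hΓ.2 hS.2 hL₂ hCS.2 ((List.mem_append.1 hP).resolve_left hP₁) hC₂).tensor_right
        hf (hb.on_compl (hf₁.restrict_eq_nil hΓ.1)) hΓ.1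
  | @curry A' Γ B' f hf ih =>
    simp only [Formula.reduced_cons, PrimeFormula.reduced_imp] at hS
    simp only [Formula.on_cons, PrimeFormula.on_imp] at hCS
    have hΓ' : Formula.Reduced (A' ++ Γ) := Formula.reduced_append.2 ⟨hS.1.2.2.1, hΓ⟩
    exact (ih hΓ' hS.1.2.2.2 hL.uncurry hCS.1.2 (List.mem_append_right _ hP) (fun Q hQ =>
      (List.mem_append.1 hQ).elim (fun h => .inr (.inr (hCS.1.1 Q h))) (hC Q))).curry hCS.1.1
      hS.1.2.2.1 (hL.uncurry.nodup hΓ')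
      (Formula.perm_restrict_append hΓ (hL.nodup hΓ) hP hA hB hC)
  | @left X Y Δ Θ S k h hk hh ihk ih =>
    have nd := hL.nodup hΓ
    have hΓ' := hΓ
    simp only [Formula.reduced_append, Formula.reduced_cons, PrimeFormula.reduced_imp] at hΓ'
    obtain ⟨hΔ, ⟨-, hY₀, hX, hY⟩, hΘ⟩ := hΓ'
    have hYΘ : Formula.Reduced (Y ++ Θ) := Formula.reduced_append.2 ⟨hY, hΘ⟩
    have hQΘ : Formula.Reduced (.imp X Y :: Θ) := (Formula.reduced_append.1 hΓ).2
    obtain ⟨hL₁, hL₂⟩ := hL.of_left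
    have ndYΘ := hL₂.nodup hYΘ
    have ndΘ : Θ.Nodup := (List.nodup_append.1 ndYΘ).2.1
    have hC₁ := fun Q hQ => hC Q (List.mem_append_left _ hQ)
    have hC₂ := fun Q hQ => hC Q (List.mem_append_right _ (List.mem_cons_of_mem _ hQ))
    have hCQ := hC (.imp X Y) (by simp)
    have nd' := List.nodup_cons.1 (List.perm_middle.nodup_iff.1 nd)
    have nmΔ : PrimeFormula.imp X Y ∉ Δ := fun h => nd'.1 (List.mem_append_left _ h)
    have nmΘ : PrimeFormula.imp X Y ∉ Θ := fun h => nd'.1 (List.mem_append_right _ h)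
    have dj : ∀ {Q}, Q ∈ Δ → Q ∉ Θ := fun h₁ h₂ =>
      List.disjoint_of_nodup_append nd h₁ (List.mem_cons_of_mem _ h₂)
    by_cases e : PrimeFormula.imp X Y = .imp A B
    · obtain ⟨rfl, rfl⟩ := PrimeFormula.imp.inj e
      have hbΔ := Formula.bicolored_of_not_mem hC₁ nmΔ
      have hbΘ := Formula.bicolored_of_not_mem hC₂ nmΘ
      obtain ⟨_, _, _, -, hk₂, -⟩ := hk.splits C hΔ hX hL₁ hbΔ (List.append_nil X).symm hA
        (by simp)
      have hbYΘ := Formula.bicolored_append.2 ⟨hB.bicolored_compl, hbΘ⟩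
      obtain ⟨_, _, _, hh₁, -⟩ := hh.splits C hYΘ hS hL₂ hbYΘ (List.nil_append S).symm (by simp)
        hCS
      exact .of_left hk hh hΓ hA hB (hbΔ.on (hk₂.restrict_eq_nil hΔ))
        (Formula.on_append.1 (hbYΘ.on_compl (hh₁.restrict_eq_nil hYΘ))).2
    have hP' : PrimeFormula.imp A B ∈ Δ ∨ PrimeFormula.imp A B ∈ Θ := by
      simp only [List.mem_append, List.mem_cons] at hP
      exact hP.imp_right fun h => h.resolve_left (Ne.symm e)
    rcases hCQ.resolve_left e with hQ | hQ <;> have hQ' := PrimeFormula.on_imp.1 hQ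
    · rcases hP' with hPΔ | hPΘ
      -- Impossible case: the continuation `h` would have the nonempty `Y` on `C` in its source,
      -- while its target avoids `C`.
      · have hbYΘ := Formula.bicolored_append.2
          ⟨hQ'.2.bicolored, Formula.bicolored_of_not_mem hC₂ (dj hPΔ)⟩
        obtain ⟨_, _, _, hh₁, -⟩ := hh.splits C hYΘ hS hL₂ hbYΘ (List.nil_append S).symm (by simp)
          hCS
        have := hh₁.restrict_eq_nil hYΘ
        rw [Formula.restrict_append, Formula.restrict_eq_self hQ'.2] at this
        exact absurd (List.append_eq_nil_iff.1 this).1 hY₀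
      · have hbΔ := Formula.bicolored_of_not_mem hC₁ (fun h => dj h hPΘ)
        obtain ⟨_, _, _, -, hk₂, -⟩ := hk.splits C hΔ hX hL₁ hbΔ (List.append_nil X).symm hQ'.1
          (by simp)
        exact .left_of_on hk (ih hYΘ hS hL₂ hCS (List.mem_append_right _ hPΘ) (fun Q h =>
          (List.mem_append.1 h).elim (fun h => .inr (.inl (hQ'.2 Q h))) (hC₂ Q)))
          (hbΔ.on (hk₂.restrict_eq_nil hΔ)) hQ hΓ ndYΘ
          (Formula.perm_restrict_append hΘ ndΘ hPΘ hA hB hC₂)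
    · rcases hP' with hPΔ | hPΘ
      · have hbYΘ := Formula.bicolored_append.2
          ⟨hQ'.2.bicolored_compl, Formula.bicolored_of_not_mem hC₂ (dj hPΔ)⟩
        obtain ⟨_, _, _, hh₁, -⟩ := hh.splits C hYΘ hS hL₂ hbYΘ (List.nil_append S).symm (by simp)
          hCS
        exact .left_argument (ihk hΔ hX hL₁ hQ'.1 hPΔ hC₁) hh
          (Formula.on_append.1 (hbYΘ.on_compl (hh₁.restrict_eq_nil hYΘ))).2 hQ hQΘ
      · have hbΔ := Formula.bicolored_of_not_mem hC₁ (fun h => dj h hPΘ)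
        obtain ⟨_, _, _, hk₁, -⟩ := hk.splits C hΔ hX hL₁ hbΔ (List.nil_append X).symm (by simp)
          hQ'.1
        exact .left_of_on_compl hk (ih hYΘ hS hL₂ hCS (List.mem_append_right _ hPΘ) (fun Q h =>
          (List.mem_append.1 h).elim (fun h => .inr (.inr (hQ'.2 Q h))) (hC₂ Q)))
          (hbΔ.on_compl (hk₁.restrict_eq_nil hΔ)) hQ hΓ ndYΘ
          (Formula.perm_restrict_append hΘ ndΘ hPΘ hA hB hC₂)
  | @perm Γ Γ' S f σ hf hσ ih =>
    exact (ih (hΓ.perm hσ.perm) hS (hL.perm hσ.perm) hCS (hσ.perm.mem_iff.1 hP)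
      (fun Q hQ => hC Q (hσ.perm.mem_iff.2 hQ))).perm hσ

end

/-- The base cases of coherence: derivations of `I ⊢ I` and `p ⊢ p` may still contain trivial
tensors and exchanges, but no left rule. -/
theorem CutFree.eq_one {Γ S : Formula V} {f : Arr V} (h : CutFree Γ S f)
    (hΓ : Formula.Reduced Γ) :
    (Γ = [] → S = [] → f = 1) ∧ ∀ p : V, Γ = [.letter p] → S = [.letter p] → f = one Γ := by
  induction h with
  | letter q => simp
  | unit => simp
  | @tensor Γ Δ S T f g hf hg ihf ihg =>
    rw [Formula.reduced_append] at hΓ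
    have ihf := ihf hΓ.1
    have ihg := ihg hΓ.2
    constructor
    · intro h₁ h₂
      rw [List.append_eq_nil_iff] at h₁ h₂
      rw [ihf.1 h₁.1 h₂.1, ihg.1 h₁.2 h₂.2, mul_one]
    · intro p h₁ h₂
      rw [List.append_eq_singleton_iff] at h₁ h₂
      rcases h₂ with ⟨h₂, h₂'⟩ | ⟨h₂, h₂'⟩
      · have e := hf.eq_nil hΓ.1 h₂
        have e' : Δ = [.letter p] := by
          rcases h₁ with h₁ | h₁
          · exact h₁.2
          · simp [e] at h₁
        rw [ihf.1 e h₂, ihg.2 p e' h₂', one_mul, e]; rfl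
      · have e := hg.eq_nil hΓ.2 h₂'
        have e' : Γ = [.letter p] := by
          rcases h₁ with h₁ | h₁
          · simp [e] at h₁
          · exact h₁.1
        rw [ihg.1 e h₂', ihf.2 p e' h₂, mul_one, e, List.append_nil]
  | curry => simp
  | @left A B Δ Θ S k h hk hh =>
    refine ⟨fun h => by simp at h, fun p h => ?_⟩
    rw [List.append_eq_singleton_iff] at h
    simp at h
  | @perm Γ Γ' S f σ hf hσ ih =>
    have ih := ih (hΓ.perm hσ.perm)
    constructor
    · rintro rfl h
      rw [ih.1 (hσ.eq_one rfl).1 h, (hσ.eq_one rfl).2]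
      exact one_comp (ty_one [])
    · rintro p rfl h
      have e := List.perm_singleton.1 hσ.perm.symm
      subst e
      rw [ih.2 p rfl h, one_comp hσ.ty]
      exact hσ.unique (Str.refl _) (by simp)

-- Coherence for reduced sequents

/-- Coherence for reduced linear sequents. -/
theorem CutFree.eq_of_linear {Γ S : Formula V} {f : Arr V} (h : CutFree Γ S f) {g : Arr V}
    (hg : CutFree Γ S g) (hΓ : Formula.Reduced Γ) (hS : Formula.Reduced S) (hL : Linear Γ S) :
    f = g := by
  induction h generalizing g with
  | letter p => exact ((hg.eq_one hΓ).2 p rfl rfl).symm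
  | unit => exact ((hg.eq_one hΓ).1 rfl rfl).symm
  | @tensor Γ Δ S T f₁ f₂ hf₁ hf₂ ih₁ ih₂ =>
    have nd := hL.nodup hΓ
    obtain ⟨C, c₁, c₂, c₃, c₄⟩ := hf₁.exists_on hL
    obtain ⟨g₁, g₂, σ, hg₁, hg₂, hσ, rfl⟩ := hg.splits C hΓ hS hL
      (Formula.bicolored_append.2 ⟨c₁.bicolored, c₃.bicolored_compl⟩) rfl c₂ c₄
    rw [Formula.reduced_append] at hΓ hS
    obtain ⟨hL₁, hL₂⟩ := hL.of_append
    rw [Formula.restrict_append, Formula.restrict_eq_self c₁, Formula.restrict_eq_nil hΓ.2 c₃,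
      List.append_nil] at hg₁ hσ
    rw [Formula.restrict_append, Formula.restrict_eq_self c₃,
      Formula.restrict_compl_eq_nil hΓ.1 c₁, List.nil_append] at hg₂ hσ
    rw [ih₁ hg₁ hΓ.1 hS.1 hL₁, ih₂ hg₂ hΓ.2 hS.2 hL₂, hσ.unique (Str.refl _) nd,
      comp_one (hg₁.ty.tensor hg₂.ty)]
  | @curry A Γ B f hf ih =>
    simp only [Formula.reduced_cons, PrimeFormula.reduced_imp] at hS
    have hg' : (eps A B ⊚ (one A * g)).Ty (A ++ Γ) B :=
      (ty_eps A B).comp ((ty_one A).tensor hg.ty) rfl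
    -- The transpose of `g` is built with a counit, so cut elimination is invoked again before using
    -- the induction hypothesis.
    rw [ih hg'.cutFree (Formula.reduced_append.2 ⟨hS.1.2.2.1, hΓ⟩) hS.1.2.2.2 hL.uncurry,
      curry_uncurry hg.ty]
  | @left A B Δ Θ S k h hk hh ihk ih =>
    have nd := hL.nodup hΓ
    obtain ⟨hL₁, hL₂⟩ := hL.of_left
    have hΓ' := hΓ
    simp only [Formula.reduced_append, Formula.reduced_cons] at hΓ'
    obtain ⟨hΔ, hP, hΘ⟩ := hΓ'
    obtain ⟨-, -, hA, hB⟩ := PrimeFormula.reduced_imp.1 hP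
    have hYΘ : Formula.Reduced (B ++ Θ) := Formula.reduced_append.2 ⟨hB, hΘ⟩
    -- The two premises side by side have the same signed occurrences as the conclusion, so
    -- `exists_on` separates their letters.
    have hL' : Linear (Δ ++ (B ++ Θ)) (A ++ S) := by
      refine (List.Perm.nodup_iff ?_).1 hL
      simp only [Formula.negOccs_append, Formula.negOccs_cons_imp, Formula.occs_append,
        List.append_assoc]
      refine List.Perm.append_left _ ?_
      simp only [← List.append_assoc]
      refine List.Perm.append_right _ ?_
      simp only [List.append_assoc]
      exact List.perm_append_comm.trans (by simp)
    obtain ⟨C, c₁, c₂, c₃, c₄⟩ := hk.exists_on hL'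
    rw [Formula.on_append] at c₃
    obtain ⟨k', h', σ, hk', hh', hσ, rfl⟩ := hg.inverts c₂ c₃.1 hΓ hS hL c₄ (by simp) (by
      intro Q hQ
      simp only [List.mem_append, List.mem_cons] at hQ
      rcases hQ with hQ | hQ | hQ
      · exact .inr (.inl (c₁ Q hQ))
      · exact .inl hQ
      · exact .inr (.inr (c₃.2 Q hQ)))
    rw [Formula.restrict_append, Formula.restrict_cons_of_not_on (hP.not_on_imp c₃.1),
      Formula.restrict_eq_self c₁, Formula.restrict_eq_nil hΘ c₃.2, List.append_nil] at hk' hσ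
    rw [Formula.restrict_append, Formula.restrict_cons_of_not_on (hP.not_on_compl_imp c₂),
      Formula.restrict_eq_self c₃.2, Formula.restrict_compl_eq_nil hΔ c₁, List.nil_append]
      at hh' hσ ⊢
    rw [ihk hk' hΔ hA hL₁, ih hh' hYΘ hS hL₂, hσ.unique (Str.refl _) nd,
      comp_one (hk'.ty.appl_mul_one B Θ)]
  | @perm Γ Γ' S f σ hf hσ ih =>
    obtain ⟨τ, hτ, e, -⟩ := hσ.exists_inv
    rw [ih (hg.perm hτ) (hΓ.perm hσ.perm) hS (hL.perm hσ.perm), comp_assoc, e, comp_one hg.ty]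

-- From proper to reduced formulae

/-- Isomorphism of formulae. -/
def Iso (A B : Formula V) : Prop :=
  ∃ f g : Arr V, f.Ty A B ∧ g.Ty B A ∧ g ⊚ f = one A ∧ f ⊚ g = one B

namespace Iso

theorem refl (A : Formula V) : Iso A A :=
  ⟨one A, one A, ty_one A, ty_one A, one_comp (ty_one A), one_comp (ty_one A)⟩

theorem trans {A B C : Formula V} (h : Iso A B) (h' : Iso B C) : Iso A C := by
  obtain ⟨f, g, hf, hg, e, e'⟩ := h
  obtain ⟨f', g', hf', hg', e₁, e₁'⟩ := h'
  refine ⟨f' ⊚ f, g ⊚ g', hf'.comp hf rfl, hg.comp hg' rfl, ?_, ?_⟩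
  · rw [comp_assoc, ← comp_assoc g', e₁, one_comp hf, e]
  · rw [comp_assoc, ← comp_assoc f, e', one_comp hg', e₁']

theorem tensor {A B A' B' : Formula V} (h : Iso A B) (h' : Iso A' B') :
    Iso (A ++ A') (B ++ B') := by
  obtain ⟨f, g, hf, hg, e, e'⟩ := h
  obtain ⟨f', g', hf', hg', e₁, e₁'⟩ := h'
  refine ⟨f * f', g * g', hf.tensor hf', hg.tensor hg', ?_, ?_⟩
  · rw [tensor_comp hg hf hg' hf', e, e₁, one_mul_one]
  · rw [tensor_comp hf hg hf' hg', e', e₁', one_mul_one]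

theorem imp_right (A : Formula V) {B B' : Formula V} (h : Iso B B') :
    Iso [.imp A B] [.imp A B'] := by
  obtain ⟨f, g, hf, hg, e, e'⟩ := h
  refine ⟨f.imp A, g.imp A, hf.imp A, hg.imp A, ?_, ?_⟩
  · rw [← imp_comp A hg hf, e, imp_one]
  · rw [← imp_comp A hf hg, e', imp_one]

/-- Implication is primitively functorial only in its consequent; its contravariant action is the
transpose of application to a precomposed argument. -/
theorem imp_left {A A' : Formula V} (h : Iso A A') (B : Formula V) :
    Iso [.imp A B] [.imp A' B] := by
  obtain ⟨f, g, hf, hg, e, e'⟩ := h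
  have key : ∀ {A A' : Formula V} {f g : Arr V}, f.Ty A A' → g.Ty A' A → g ⊚ f = one A →
      (f.appl A' B).curry A [.imp A' B] ⊚ (g.appl A B).curry A' [.imp A B] =
        one [.imp A B] := by
    intro A A' f g hf hg e
    have tg := (hg.appl B).curry
    rw [← curry_comp (hf.appl B) tg, appl, comp_assoc, ← mul_eq_left hf tg, mul_eq_right hf tg,
      ← comp_assoc, uncurry_curry (hg.appl B), ← appl_comp hg hf, e, appl, one_mul_one,
      comp_one (ty_eps A B), Arr.curry, imp_eps_eta]
  exact ⟨_, _, (hg.appl B).curry, (hf.appl B).curry, key hf hg e, key hg hf e'⟩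

theorem nil_imp (B : Formula V) : Iso [.imp [] B] B := by
  have e₁ := eps_eta [] B
  have e₂ := eta_nat [] (ty_eps [] B)
  have e₃ := imp_eps_eta [] B
  simp only [one_nil, one_mul, List.nil_append] at e₁ e₂ e₃
  exact ⟨eps [] B, eta [] B, ty_eps [] B, ty_eta [] B, e₂.trans e₃, e₁⟩

end Iso

theorem Formula.Reduced.eq_nil {A : Formula V} (h : Formula.Reduced A)
    (e : Formula.occs A = []) : A = [] := by
  cases A with
  | nil => rfl
  | cons P A =>
    rw [Formula.occs_cons, List.append_eq_nil_iff] at e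
    exact absurd e.1 (Formula.reduced_cons.1 h).1.occs_ne_nil

-- Bottom up, each `[] → B` is replaced by `B`. If `A → B` keeps a nonempty antecedent, then `A` is
-- not constant, so by properness neither is `B`, and its reduced form is nonempty. Equality of
-- occurrences lets linearity pass to the reduced sequent.
mutual
theorem PrimeFormula.Proper.exists_reduced : ∀ P : PrimeFormula V, P.Proper →
    ∃ A : Formula V, Formula.Reduced A ∧ Formula.occs A = P.occs ∧ Iso [P] A
  | .letter p, _ => ⟨[.letter p], by simpa using .letter p, by simp, .refl _⟩
  | .imp A B, h => by
    rw [PrimeFormula.Proper] at h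
    obtain ⟨A', hA, eA, iA⟩ := Formula.Proper.exists_reduced A h.1
    obtain ⟨B', hB, eB, iB⟩ := Formula.Proper.exists_reduced B h.2.1
    have i : Iso [.imp A B] [.imp A' B'] := (iA.imp_left B).trans (iB.imp_right A')
    rw [PrimeFormula.occs_imp, negOccs, ← eA, ← eB]
    by_cases hA' : A' = []
    · subst hA'
      exact ⟨B', hB, by simp, i.trans (.nil_imp B')⟩
    · refine ⟨[.imp A' B'], ?_, by simp [negOccs], i⟩
      simp only [Formula.reduced_cons, PrimeFormula.reduced_imp, Formula.reduced_nil, and_true]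
      refine ⟨hA', ?_, hA, hB⟩
      rintro rfl
      refine h.2.2 ⟨?_, fun hc => hA' (hA.eq_nil (eA.trans hc))⟩
      rw [Formula.Constant, ← eB, Formula.occs_nil]
theorem Formula.Proper.exists_reduced : ∀ A : List (PrimeFormula V), Formula.Proper A →
    ∃ A' : Formula V, Formula.Reduced A' ∧ Formula.occs A' = Formula.occs A ∧ Iso A A'
  | [], _ => ⟨[], by simp, rfl, .refl _⟩
  | P :: A, h => by
    rw [Formula.Proper] at h
    obtain ⟨P', hP, eP, iP⟩ := PrimeFormula.Proper.exists_reduced P h.1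
    obtain ⟨A', hA, eA, iA⟩ := Formula.Proper.exists_reduced A h.2
    exact ⟨P' ++ A', by simp [hP, hA], by simp [eP, eA], iP.tensor iA⟩
end

/-- Coherence for proper linear sequents. -/
theorem Arr.Ty.eq_of_linear {A B : Formula V} {f g : Arr V} (hf : f.Ty A B) (hg : g.Ty A B)
    (hL : Linear A B) (hA : Formula.Proper A) (hB : Formula.Proper B) : f = g := by
  obtain ⟨A', rA, eA, i, i', hi, hi', ei, -⟩ := Formula.Proper.exists_reduced A hA
  obtain ⟨B', rB, eB, j, j', hj, hj', ej, -⟩ := Formula.Proper.exists_reduced B hB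
  have hL' : Linear A' B' := by rwa [Linear, negOccs, eA, eB]
  have ty : ∀ {f : Arr V}, f.Ty A B → (j ⊚ f ⊚ i').Ty A' B' := fun hf =>
    hj.comp (hf.comp hi' rfl) rfl
  -- Conjugation by the two isomorphisms is injective, so equality can be tested on the reduced
  -- sequent.
  have cancel : ∀ {f : Arr V}, f.Ty A B → j' ⊚ (j ⊚ f ⊚ i') ⊚ i = f := fun hf => by
    simp only [comp_assoc]
    rw [ei, comp_one hf, ← comp_assoc, ej, one_comp hf]
  rw [← cancel hf, ← cancel hg, (ty hf).cutFree.eq_of_linear (ty hg).cutFree rA rB hL']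

theorem BalancedSequent.linear [DecidableEq V] {A B : Formula V} (h : BalancedSequent A B) :
    Linear A B := by
  have e : negOccs A ++ Formula.occs B = Formula.occs (Formula.imp A B) := by simp
  rw [Linear, e, List.nodup_iff_count_le_one]
  rintro ⟨p, s⟩
  by_cases hp : (p, s) ∈ Formula.occs (Formula.imp A B)
  · cases s
    · exact (h p ⟨_, hp⟩).2.le
    · exact (h p ⟨_, hp⟩).1.le
  · rw [List.count_eq_zero_of_not_mem hp]
    exact Nat.zero_le 1

end IL

theorem mainTheorem1 {V : Type*} [DecidableEq V] {A B : IL.Formula V} {f g : IL.Term V}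
    (hf : f.HasType A B) (hg : g.HasType A B)
    (hbalanced : IL.BalancedSequent A B) (hproper : IL.ProperSequent A B) :
    IL.TermEq A B f g :=
  IL.Arr.termEq_of_mk_eq hf
    (IL.Arr.Ty.eq_of_linear (f := .mk f) (g := .mk g) hf hg hbalanced.linear hproper.1 hproper.2)
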